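/- Let $\mathcal M_1=(V,\mathcal I_1)$ and $\mathcal M_2=(V,\mathcal I_2)$ be two matroids on a common ground set $V$ of size $n\ge 2$, each accessible only through an independence oracle (a query names a matroid $i\in\{1,2\}$ and a set $S\subseteq V$ and returns whether $S\in\mathcal I_i$), and let $r=\max\{|S| : S\in\mathcal I_1\cap\mathcal I_2\}$ (which is not given to the algorithm). A randomized independence-query algorithm is a finite randomized adaptive decision procedure that knows $V$ and $\varepsilon$, may draw uniformly random elements of finite sets $\{0,\dots,m\}$, adaptively asks independence queries, and finally outputs a subset of $V$; its cost is the number of queries asked. For every constant $c\in\mathbb N$ there is a constant $C>0$, depending only on $c$, such that for every finite set $V$ with $n=|V|\ge 2$ and every $\varepsilon\in(0,1)$ there is a randomized independence-query algorithm such that for all matroids $\mathcal M_1,\mathcal M_2$ on $V$: on every outcome of its random choices it asks at most $$C\left(\frac{n\log n}{\varepsilon}+\frac{r\log^3 n}{\varepsilon^5}\right)$$ independence queries, and with probability at least $1-n^{-c}$ its output $S$ satisfies $S\in\mathcal I_1\cap\mathcal I_2$ and $|S|\ge(1-\varepsilon)r$. -/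

import Mathlib

universe u

/-- A randomized query algorithm with access to two independence oracles (numbered `0` and `1`)
on the subsets of a finite ground set `V`, as a finite-depth decision tree. At each point of its
execution it either stops and outputs a subset of `V`, or asks oracle `i` whether `S` is independent
and continues depending on the answer, or draws a uniformly random element of `{0, …, m}`
(independent of all earlier draws) and continues depending on it. The tree is all the algorithm
has: it reaches the matroids only through the answers to its queries. -/
inductive QueryAlg (V : Type u) : Type u
  | output (S : Finset V) : QueryAlg V
  | query (i : Fin 2) (S : Finset V) (next : Bool → QueryAlg V) : QueryAlg V
  | draw (m : ℕ) (next : Fin (m + 1) → QueryAlg V) : QueryAlg V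

namespace QueryAlg

/-- The joint distribution of (output set, number of oracle queries asked) when the algorithm is
run against the oracles `O 0` and `O 1`. Every query costs `1`; random draws are free. -/
noncomputable def run {V : Type u} (O : Fin 2 → Finset V → Bool) :
    QueryAlg V → PMF (Finset V × ℕ)
  | output S => PMF.pure (S, 0)
  | query i S next => (run O (next (O i S))).map fun p => (p.1, p.2 + 1)
  | draw m next => (PMF.uniformOfFintype (Fin (m + 1))).bind fun j => run O (next j)

end QueryAlg

open Classical in
/-- The independence oracles of two matroids: on a query `S`, oracle `i` reports whether `S` is
independent in `M i`. -/
noncomputable def indepOracle {V : Type u} (M : Fin 2 → Matroid V) : Fin 2 → Finset V → Bool :=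
  fun i S => decide ((M i).Indep (S : Set V))

/-- `S` is a common independent set of the two matroids. -/
def CommonIndep {V : Type u} (M : Fin 2 → Matroid V) (S : Finset V) : Prop :=
  ∀ i, (M i).Indep (S : Set V)

/-- The size `r` of a largest common independent set of the two matroids. -/
noncomputable def maxCommonIndep {V : Type u} (M : Fin 2 → Matroid V) : ℕ :=
  sSup {k | ∃ S : Finset V, CommonIndep M S ∧ S.card = k}

/-- On a finite ground set the supremum is a maximum over a nonempty set. -/
theorem isGreatest_maxCommonIndep {V : Type u} [Fintype V] (M : Fin 2 → Matroid V) :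
    IsGreatest {k | ∃ S : Finset V, CommonIndep M S ∧ S.card = k} (maxCommonIndep M) := by
  have hne : {k | ∃ S : Finset V, CommonIndep M S ∧ S.card = k}.Nonempty :=
    ⟨0, ∅, fun i => by simp, rfl⟩
  have hbdd : BddAbove {k | ∃ S : Finset V, CommonIndep M S ∧ S.card = k} :=
    ⟨Fintype.card V, by rintro k ⟨S, -, rfl⟩; exact S.card_le_univ⟩
  exact ⟨Nat.sSup_mem hne hbdd, fun k hk => le_csSup hbdd hk⟩

/-! A greedy maximal common independent set has at least half the optimal size `r`. Truncating the
first matroid to rank `k`, twice the greedy size, keeps an optimum `J` and bounds every certificate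
by `k` elements. The truncated instance is solved by multiplicative weights. Each round samples
about `r log n / ε` elements, `e` with weight `2 ^ cnt e`, and solves the sample deterministically
(`auction_spec`). This gives a common independent set `I` and sets `B₁`, `B₂` whose closures cover
the sample, with `|B₁| + |B₂|` close to `|I|`. Elements of `V` in neither closure double their
weight.

Two facts collide. There are few pairs `(B₁, B₂)`, so by a union bound (`ncard_badDraws_le`) the
uncovered set very likely has at most an `ε/8` fraction of the weight, and the total grows by a
factor at most `1 + ε/8`. But if `|I| < (1 - ε) |J|`, weak duality leaves at least `ε/2 * |J|`
elements of `J` uncovered (`le_card_inter_uncovered`). After about `5 log n / ε` bad rounds some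
element of `J` would outweigh the whole ground set (`ReweightInvariant.good`).

The auction gives elements levels so that each threshold `s` is a dual cover: the part of `D` up to
level `s` spans the levels up to `s` in the first matroid, and the part of `I` from level `s` on
spans the levels above `s` in the second. A step at a level where `D` exceeds `I` lowers a potential
(`LevelState.Invariant.step`). Once every level below `L` is balanced, averaging yields a threshold
whose cover is within `(|I| + k) / L` of `|I|`. Here `L` is about `16 / ε`, and the auction costs
`O(L ^ 3)` queries per sampled element. -/

open Finset

/-! ### Decision trees: deterministic query cost and random rounds. -/

section QueryComplexity

variable {V : Type u}

/-- `QueryComputable q f` says that the value `f O` can be found with at most `q` queries to the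
oracles `O`. -/
inductive QueryComputable {V : Type u} {α : Type*} :
    ℕ → ((Fin 2 → Finset V → Bool) → α) → Prop
  | const (q : ℕ) (a : α) : QueryComputable q fun _ => a
  | query {q : ℕ} (i : Fin 2) (S : Finset V) {g : Bool → (Fin 2 → Finset V → Bool) → α}
      (hg : ∀ b, QueryComputable q (g b)) : QueryComputable (q + 1) fun O => g (O i S) O

namespace QueryComputable

variable {α β : Type*} {f : (Fin 2 → Finset V → Bool) → α}

theorem mono {p q : ℕ} (hf : QueryComputable p f) (hpq : p ≤ q) : QueryComputable q f := by
  induction hf generalizing q with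
  | const p a => exact const q a
  | query i S hg ih =>
    obtain ⟨q, rfl⟩ : ∃ q', q = q' + 1 := ⟨q - 1, by omega⟩
    exact query i S fun b => ih b (by omega)

theorem bind {p q : ℕ} {g : α → (Fin 2 → Finset V → Bool) → β}
    (hf : QueryComputable p f) (hg : ∀ a, QueryComputable q (g a)) :
    QueryComputable (p + q) fun O => g (f O) O := by
  induction hf with
  | const p a => exact (hg a).mono (by omega)
  | @query p i S f' _ ih =>
    rw [add_right_comm]
    exact query (g := fun b O => g (f' b O) O) i S ih

theorem map {q : ℕ} (g : α → β) (hf : QueryComputable q f) :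
    QueryComputable q fun O => g (f O) :=
  hf.bind (q := 0) (g := fun a _ => g a) fun a => const 0 (g a)

theorem ask (i : Fin 2) (S : Finset V) : QueryComputable 1 fun O => O i S :=
  query (g := fun b _ => b) i S fun b => const 0 b

theorem foldl {σ ι : Type*} {q : ℕ} {step : (Fin 2 → Finset V → Bool) → σ → ι → σ}
    (hstep : ∀ s x, QueryComputable q fun O => step O s x) (l : List ι) (s : σ) :
    QueryComputable (l.length * q) fun O => l.foldl (step O) s := by
  induction l generalizing s with
  | nil => exact const _ s
  | cons x l ih =>
    have := (hstep s x).bind ih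
    simpa [add_mul, add_comm] using this

theorem iterate {σ : Type*} {q : ℕ} {step : (Fin 2 → Finset V → Bool) → σ → σ}
    (hstep : ∀ s, QueryComputable q fun O => step O s) (m : ℕ) (s : σ) :
    QueryComputable (m * q) fun O => (step O)^[m] s := by
  induction m generalizing s with
  | zero => exact const _ s
  | succ m ih =>
    have := (hstep s).bind ih
    simpa [add_mul, add_comm] using this

theorem filter {q : ℕ} {ind : (Fin 2 → Finset V → Bool) → V → Bool}
    (hind : ∀ e, QueryComputable q fun O => ind O e) (S : Finset V) :
    QueryComputable (S.card * q) fun O => S.filter fun e => ind O e := by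
  classical
  induction S using Finset.induction_on with
  | empty => exact const _ ∅
  | insert a S ha ih =>
    rw [card_insert_of_notMem ha, add_mul, one_mul]
    have := ih.bind fun T => (hind a).map fun b => if b then insert a T else T
    simpa [filter_insert] using this

/-- Queries can be answered through queries to other oracles. -/
theorem comp {q : ℕ} (hf : QueryComputable q f)
    (tr : (Fin 2 → Finset V → Bool) → Fin 2 → Finset V → Bool)
    (htr : ∀ i S, QueryComputable 1 fun O => tr O i S) :
    QueryComputable q fun O => f (tr O) := by
  induction hf with
  | const p a => exact const p a
  | @query p i S g _ ih =>
    rw [add_comm]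
    exact (htr i S).bind (g := fun b O => g b (tr O)) ih

/-- A value found with `q` queries may be used to choose how to proceed. -/
theorem exists_queryAlg {α : Type*} {f : (Fin 2 → Finset V → Bool) → α} {q : ℕ}
    (hf : QueryComputable q f) (K : α → QueryAlg V) :
    ∃ A : QueryAlg V, ∀ O, ∃ d ≤ q, A.run O = ((K (f O)).run O).map fun p => (p.1, p.2 + d) := by
  induction hf with
  | const q a =>
    refine ⟨K a, fun O => ⟨0, by omega, ?_⟩⟩
    exact (PMF.map_id _).symm
  | @query p i S g _ ih =>
    choose A hA using ih
    refine ⟨.query i S A, fun O => ?_⟩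
    obtain ⟨d, hd, h⟩ := hA (O i S) O
    refine ⟨d + 1, by omega, ?_⟩
    rw [QueryAlg.run, h, PMF.map_comp]
    rfl

end QueryComputable

namespace QueryAlg

/-- Draw a uniformly random element of a nonempty finite type. -/
noncomputable def drawFrom (α : Type*) [Fintype α] [Nonempty α] (K : α → QueryAlg V) :
    QueryAlg V :=
  -- `draw m` has `m + 1` outcomes, hence the predecessor.
  draw (Fintype.card α - 1) fun j =>
    K ((Fintype.equivFin α).symm (Fin.cast (Nat.sub_add_cancel Fintype.card_pos) j))

variable {α : Type*} [Fintype α] [Nonempty α] (K : α → QueryAlg V)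
  (O : Fin 2 → Finset V → Bool)

theorem mem_support_run_drawFrom {p : Finset V × ℕ} (hp : p ∈ ((drawFrom α K).run O).support) :
    ∃ a, p ∈ ((K a).run O).support := by
  rw [drawFrom, run, PMF.mem_support_bind_iff] at hp
  obtain ⟨j, -, h⟩ := hp
  exact ⟨_, h⟩

theorem toOuterMeasure_run_drawFrom (s : Set (Finset V × ℕ)) :
    ((drawFrom α K).run O).toOuterMeasure s
      = (∑ a, ((K a).run O).toOuterMeasure s) / Fintype.card α := by
  have hcard : Fintype.card α - 1 + 1 = Fintype.card α := Nat.sub_add_cancel Fintype.card_pos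
  rw [drawFrom, run, PMF.toOuterMeasure_bind_apply, tsum_fintype, ENNReal.div_eq_inv_mul,
    Finset.mul_sum, ← ((finCongr hcard).trans (Fintype.equivFin α).symm).sum_comp]
  refine Finset.sum_congr rfl fun j _ => ?_
  rw [PMF.uniformOfFintype_apply, Fintype.card_fin]
  exact congrArg (fun x : ENNReal => x⁻¹ * _) (congrArg Nat.cast hcard)

end QueryAlg

theorem PMF.toOuterMeasure_le_one {β : Type*} (p : PMF β) (s : Set β) :
    p.toOuterMeasure s ≤ 1 := by
  refine (p.toOuterMeasure.mono (Set.subset_univ s)).trans ?_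
  exact ((p.toOuterMeasure_apply_eq_one_iff _).2 (Set.subset_univ _)).le

theorem PMF.one_sub_le_toReal_toOuterMeasure {β : Type*} (p : PMF β) (s : Set β) {δ : ℝ}
    (hδ : 0 ≤ δ) (h : p.toOuterMeasure sᶜ ≤ ENNReal.ofReal δ) :
    1 - δ ≤ (p.toOuterMeasure s).toReal := by
  have h1 : (1 : ENNReal) ≤ p.toOuterMeasure s + p.toOuterMeasure sᶜ := by
    rw [← (p.toOuterMeasure_apply_eq_one_iff Set.univ).2 (Set.subset_univ _),
      ← Set.union_compl_self s]
    exact MeasureTheory.measure_union_le _ _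
  have hs : p.toOuterMeasure s ≠ ⊤ :=
    ((p.toOuterMeasure_le_one s).trans_lt ENNReal.one_lt_top).ne
  have h2 := h1.trans (add_le_add_right h (p.toOuterMeasure s))
  have h3 := ENNReal.toReal_mono (by simp [hs]) h2
  rw [ENNReal.toReal_add hs ENNReal.ofReal_ne_top, ENNReal.toReal_ofReal hδ] at h3
  simp only [ENNReal.toReal_one] at h3
  linarith

/-- An algorithm working in `T` rounds, each of which draws a random element of a type that depends
on the current state and then spends at most `q` queries on the next state. If in every round all
but a fraction `δ` of the draws preserve an invariant, then the invariant holds at the end except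
with probability `T * δ`. -/
theorem exists_queryAlg_rounds {σ : Type*} (Ω : σ → Type*) [∀ s, Fintype (Ω s)]
    [∀ s, Nonempty (Ω s)] (next : (s : σ) → Ω s → (Fin 2 → Finset V → Bool) → σ) {q : ℕ}
    (hq : ∀ s ω, QueryComputable q (next s ω)) (out : σ → Finset V) (T : ℕ) (s₀ : σ) :
    ∃ A : QueryAlg V, ∀ O : Fin 2 → Finset V → Bool,
      (∀ p ∈ (A.run O).support, p.2 ≤ T * q) ∧
      ∀ (G : Set (Finset V)) (δ : ENNReal) (Inv : ℕ → σ → Prop),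
        (∀ j s, Inv (j + 1) s →
          (Nat.card {ω : Ω s // ¬ Inv j (next s ω O)} : ENNReal) ≤ δ * Fintype.card (Ω s)) →
        (∀ s, Inv 0 s → out s ∈ G) → Inv T s₀ →
        (A.run O).toOuterMeasure {p | p.1 ∈ G}ᶜ ≤ T * δ := by
  classical
  induction T generalizing s₀ with
  | zero =>
    refine ⟨.output (out s₀), fun O => ⟨?_, fun G δ Inv _ hG h0 => ?_⟩⟩
    · intro p hp
      rw [QueryAlg.run, PMF.mem_support_pure_iff] at hp
      simp [hp]
    · rw [QueryAlg.run, PMF.toOuterMeasure_pure_apply, if_neg (by simpa using hG _ h0)]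
      simp
  | succ T ih =>
    choose A hA using ih
    choose B hB using fun ω => (hq s₀ ω).exists_queryAlg A
    refine ⟨.drawFrom (Ω s₀) B, fun O => ⟨?_, fun G δ Inv hstep hG h0 => ?_⟩⟩
    · intro p hp
      obtain ⟨ω, hω⟩ := QueryAlg.mem_support_run_drawFrom B O hp
      obtain ⟨d, hd, h⟩ := hB ω O
      rw [h, PMF.mem_support_map_iff] at hω
      obtain ⟨p', hp', rfl⟩ := hω
      have := (hA _ O).1 p' hp'
      simp only [add_mul, one_mul]
      omega
    · rw [QueryAlg.toOuterMeasure_run_drawFrom]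
      refine ENNReal.div_le_of_le_mul ?_
      -- A draw that breaks the invariant is charged failure probability 1; any other is left to the
      -- remaining rounds.
      have hval : ∀ ω, ((B ω).run O).toOuterMeasure {p | p.1 ∈ G}ᶜ
          ≤ T * δ + if Inv T (next s₀ ω O) then 0 else 1 := by
        intro ω
        obtain ⟨d, -, h⟩ := hB ω O
        split_ifs with hinv
        · rw [h, PMF.toOuterMeasure_map_apply, add_zero]
          exact (hA _ O).2 G δ Inv hstep hG hinv
        · exact (PMF.toOuterMeasure_le_one _ _).trans le_add_self
      refine (Finset.sum_le_sum fun ω _ => hval ω).trans ?_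
      rw [Finset.sum_add_distrib, Finset.sum_const, nsmul_eq_mul, Finset.card_univ]
      have hbad : (∑ ω, if Inv T (next s₀ ω O) then (0 : ENNReal) else 1)
          ≤ δ * Fintype.card (Ω s₀) := by
        refine le_trans (le_of_eq ?_) (hstep T s₀ h0)
        rw [Nat.card_eq_fintype_card, Fintype.card_subtype, Finset.card_filter]
        push_cast
        exact Finset.sum_congr rfl fun ω _ => by split_ifs <;> simp_all
      refine (add_le_add_right hbad _).trans (le_of_eq ?_)
      push_cast
      ring

end QueryComplexity

/-! ### Closure, exchange, truncation and weak duality. -/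

section MatroidLemmas

variable {V : Type u}

namespace Matroid

variable {M : Matroid V}

theorem Indep.mem_closure_of_not_indep_insert (hE : M.E = Set.univ) {X : Set V} {e : V}
    (hX : M.Indep X) (h : ¬ M.Indep (insert e X)) : e ∈ M.closure X := by
  by_contra hcon
  exact h (((hX.notMem_closure_iff (by simp [hE])).1 hcon).1)

theorem Indep.card_le_of_subset_closure {Z Y : Finset V} (hZ : M.Indep (Z : Set V))
    (h : (Z : Set V) ⊆ M.closure Y) : Z.card ≤ Y.card := by
  have h1 := (hZ.encard_le_eRk_of_subset h).trans
    ((M.eRk_closure_eq Y).le.trans (M.eRk_le_encard Y))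
  simpa [Set.encard_coe_eq_coe_finsetCard] using h1

/-- The closure of `Z ∪ W` stays inside that of `Y ∪ W`, so an element that extends the latter also
extends the former. The auction uses this to exchange the low part of its basis. -/
theorem Indep.union_of_subset_closure [DecidableEq V] (hE : M.E = Set.univ) {Z Y W : Finset V}
    (hZ : M.Indep (Z : Set V)) (h : (Z : Set V) ⊆ M.closure Y)
    (hYW : M.Indep ((Y ∪ W : Finset V) : Set V)) (hd : Disjoint Y W) :
    M.Indep ((Z ∪ W : Finset V) : Set V) := by
  induction W using Finset.induction_on with
  | empty => simpa using hZ
  | insert a W ha ih =>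
    rw [disjoint_insert_right] at hd
    have hYW' : M.Indep ((Y ∪ W : Finset V) : Set V) := hYW.subset (by
      push_cast; exact Set.union_subset_union_right _ (Set.subset_insert _ _))
    have hZW := ih hYW' hd.2
    rw [union_insert, coe_insert] at hYW ⊢
    have ha' : a ∉ M.closure ((Y ∪ W : Finset V) : Set V) := by
      rw [hYW'.notMem_closure_iff (by simp [hE])]
      exact ⟨hYW, by simpa [hd.1] using ha⟩
    have hsub : ((Z ∪ W : Finset V) : Set V) ⊆ M.closure ((Y ∪ W : Finset V) : Set V) := by
      push_cast
      refine Set.union_subset (h.trans (M.closure_subset_closure Set.subset_union_left)) ?_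
      exact Set.subset_union_right.trans (M.subset_closure _ (by simp [hE]))
    have ha2 : a ∉ M.closure ((Z ∪ W : Finset V) : Set V) := fun hc =>
      ha' (M.closure_subset_closure_of_subset_closure hsub hc)
    exact ((hZW.notMem_closure_iff (by simp [hE])).1 ha2).1

/-- The truncation of a matroid to rank at most `k`. -/
noncomputable def truncateTo [DecidableEq V] (M : Matroid V) (k : ℕ) : Matroid V :=
  (IndepMatroid.ofFinset M.E (fun I => M.Indep (I : Set V) ∧ I.card ≤ k)
    ⟨by simp, by simp⟩
    (fun I J hJ h => ⟨hJ.1.subset (by exact_mod_cast h), (card_le_card h).trans hJ.2⟩)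
    (fun I J hI hJ h => by
      obtain ⟨e, he, hIe⟩ := hI.1.augment hJ.1 (by
        simpa [Set.encard_coe_eq_coe_finsetCard] using h)
      have he' : e ∈ J ∧ e ∉ I := by simpa using he
      exact ⟨e, he'.1, he'.2, by simpa using hIe, by
        rw [card_insert_of_notMem he'.2]
        exact h.trans_le hJ.2⟩)
    (fun I hI => hI.1.subset_ground)).matroid

@[simp] theorem truncateTo_E [DecidableEq V] (M : Matroid V) (k : ℕ) :
    (M.truncateTo k).E = M.E := rfl

theorem truncateTo_indep_iff [DecidableEq V] (M : Matroid V) (k : ℕ) (I : Finset V) :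
    (M.truncateTo k).Indep (I : Set V) ↔ M.Indep (I : Set V) ∧ I.card ≤ k := by
  simp only [truncateTo, IndepMatroid.matroid_Indep, IndepMatroid.ofFinset_indep]

end Matroid

/-- Weak duality for matroid intersection. -/
theorem CommonIndep.card_le_of_subset_closure {M : Fin 2 → Matroid V} {J B₁ B₂ : Finset V}
    (hJ : CommonIndep M J)
    (h : ∀ e ∈ J, e ∈ (M 0).closure B₁ ∨ e ∈ (M 1).closure B₂) :
    J.card ≤ B₁.card + B₂.card := by
  classical
  rw [← card_filter_add_card_filter_not (s := J) fun e => e ∈ (M 0).closure B₁]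
  refine add_le_add ?_ ?_
  · refine ((hJ 0).subset ?_).card_le_of_subset_closure (M := M 0) ?_
    · exact_mod_cast filter_subset _ _
    · intro e he
      exact (mem_filter.1 (mem_coe.1 he)).2
  · refine ((hJ 1).subset ?_).card_le_of_subset_closure (M := M 1) ?_
    · exact_mod_cast filter_subset _ _
    · intro e he
      have := mem_filter.1 (mem_coe.1 he)
      exact (h e this.1).resolve_left this.2

end MatroidLemmas

theorem exists_list_pairwise_level {V : Type u} (F : Finset V) (lev : V → ℕ) :
    ∃ l : List V, l.length = F.card ∧ (∀ e, e ∈ l ↔ e ∈ F) ∧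
      l.Pairwise fun a b => lev b ≤ lev a := by
  let r : V → V → Bool := fun a b => decide (lev b ≤ lev a)
  refine ⟨F.toList.mergeSort r, by simp, fun e => by simp, ?_⟩
  have := List.pairwise_mergeSort (le := r) (by intro a b c; simp only [r, decide_eq_true_eq]; omega)
    (by intro a b; simp only [r, Bool.or_eq_true, decide_eq_true_eq]; omega) F.toList
  exact this.imp (by simp [r])

/-! ### Greedy extension of feasible sets. -/

section Greedy

variable {V : Type u} [DecidableEq V]

/-- Run through `l`, adding to `X` each element that keeps the set feasible. -/
def greedy (ind : Finset V → Bool) (l : List V) (X : Finset V) : Finset V :=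
  l.foldl (fun Y e => if ind (insert e Y) then insert e Y else Y) X

variable {ind : Finset V → Bool} {l : List V} {X : Finset V}

theorem subset_greedy : X ⊆ greedy ind l X := by
  induction l generalizing X with
  | nil => exact Subset.rfl
  | cons a l ih =>
    refine Subset.trans ?_ (ih (X := if ind (insert a X) then insert a X else X))
    split_ifs
    · exact subset_insert _ _
    · exact Subset.rfl

theorem mem_of_mem_greedy {e : V} (he : e ∈ greedy ind l X) : e ∈ X ∨ e ∈ l := by
  induction l generalizing X with
  | nil => exact Or.inl he
  | cons a l ih =>
    have := ih (X := if ind (insert a X) then insert a X else X) he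
    split_ifs at this <;> grind

theorem ind_greedy (hX : ind X) : ind (greedy ind l X) := by
  induction l generalizing X with
  | nil => exact hX
  | cons a l ih =>
    refine ih (X := if ind (insert a X) then insert a X else X) ?_
    split_ifs with h
    · exact h
    · exact hX

/-- If elements are offered by decreasing level, then an element is rejected because of the
elements of no lower level. -/
theorem not_ind_insert_greedy_filter (hind : ∀ Y Z, Y ⊆ Z → ind Z → ind Y) (lev : V → ℕ)
    (hl : l.Pairwise fun a b => lev b ≤ lev a) (hX : ∀ x ∈ X, ∀ e ∈ l, lev e ≤ lev x)
    {e : V} (he : e ∈ l) (hres : e ∉ greedy ind l X) :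
    ¬ ind (insert e ((greedy ind l X).filter fun x => lev e ≤ lev x)) := by
  induction l generalizing X with
  | nil => simp at he
  | cons a l ih =>
    rw [List.pairwise_cons] at hl
    set X' := if ind (insert a X) then insert a X else X with hX'
    have hg : greedy ind (a :: l) X = greedy ind l X' := rfl
    rw [hg] at hres ⊢
    rcases List.mem_cons.1 he with rfl | he
    -- When `e` is offered the current set is `X`, all of whose elements have level at least `lev
    -- e`, so the filter retains them.
    · intro hcon
      have hX'e : ¬ ind (insert e X) := fun h => hres (subset_greedy (by simp [hX', h]))
      refine hX'e (hind _ _ ?_ hcon)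
      refine insert_subset_insert _ fun x hx => ?_
      refine mem_filter.2 ⟨subset_greedy ?_, hX x hx e (by simp)⟩
      rw [hX', if_neg hX'e]
      exact hx
    · refine ih hl.2 (fun x hx y hy => ?_) he hres
      have : x = a ∨ x ∈ X := by
        rw [hX'] at hx
        split_ifs at hx <;> grind
      rcases this with rfl | h
      · exact hl.1 y hy
      · exact hX x h y (by simp [hy])

theorem not_ind_insert_greedy (hind : ∀ Y Z, Y ⊆ Z → ind Z → ind Y)
    {e : V} (he : e ∈ l) (hres : e ∉ greedy ind l X) : ¬ ind (insert e (greedy ind l X)) := by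
  -- With constant levels the filter keeps everything.
  have := not_ind_insert_greedy_filter hind (fun _ => 0) (l := l) (X := X)
    (List.pairwise_of_forall fun _ _ => le_rfl) (by simp) he hres
  simpa using this

theorem QueryComputable.greedy {q : ℕ} {ind : (Fin 2 → Finset V → Bool) → Finset V → Bool}
    (hind : ∀ Y, QueryComputable q fun O => ind O Y) (l : List V) (X : Finset V) :
    QueryComputable (l.length * q) fun O => greedy (ind O) l X :=
  QueryComputable.foldl
    (step := fun O Y e => if ind O (insert e Y) then insert e Y else Y)
    (fun Y e => (hind (insert e Y)).map fun b => if b then insert e Y else Y) l X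

end Greedy

/-! ### Independence oracles as monotone predicates. -/

section IndepOracle

variable {V : Type u} {M : Fin 2 → Matroid V}

theorem indepOracle_iff {i : Fin 2} {S : Finset V} :
    indepOracle M i S = true ↔ (M i).Indep (S : Set V) := by
  simp [indepOracle]

theorem indepOracle_mono {i : Fin 2} (Y Z : Finset V) (h : Y ⊆ Z) (hZ : indepOracle M i Z) :
    indepOracle M i Y :=
  indepOracle_iff.2 ((indepOracle_iff.1 hZ).subset (by exact_mod_cast h))

end IndepOracle

/-! ### One step of the auction and its invariant. -/

section LevelAlgorithm

variable {V : Type u}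

/-- State of the auction: every element has a level, `I` is the current common independent set, and
`D` is a basis of the first matroid that prefers elements of low level. -/
structure LevelState (V : Type u) : Type u where
  lev : V → ℕ
  I : Finset V
  D : Finset V

/-- An enumeration of a finite set by decreasing level. -/
noncomputable def descList (F : Finset V) (lev : V → ℕ) : List V :=
  (exists_list_pairwise_level F lev).choose

theorem length_descList (F : Finset V) (lev : V → ℕ) : (descList F lev).length = F.card :=
  (exists_list_pairwise_level F lev).choose_spec.1

theorem mem_descList {F : Finset V} {lev : V → ℕ} {e : V} : e ∈ descList F lev ↔ e ∈ F :=
  (exists_list_pairwise_level F lev).choose_spec.2.1 e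

theorem pairwise_descList (F : Finset V) (lev : V → ℕ) :
    (descList F lev).Pairwise fun a b => lev b ≤ lev a :=
  (exists_list_pairwise_level F lev).choose_spec.2.2

variable [DecidableEq V]

namespace LevelState

variable (O : Fin 2 → Finset V → Bool) (S : Finset V) (t : ℕ) (st : LevelState V)

/-- The elements of level `t` outside the current solution. -/
def offered : Finset V := S.filter fun e => st.lev e = t ∧ e ∉ st.I

/-- The part of the solution of level at least `t`. -/
def upper : Finset V := st.I.filter fun e => t ≤ st.lev e

/-- The part of the basis below level `t` together with the solution at level `t`. -/
def lower : Finset V := (st.D.filter fun e => st.lev e < t) ∪ st.I.filter fun e => st.lev e = t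

/-- The offered elements that enter the solution. -/
noncomputable def accepted : Finset V :=
  greedy (fun N => O 1 (st.upper t ∪ N) && O 0 (st.lower t ∪ N)) (st.offered S t).toList ∅

/-- The offered elements that the second matroid rejects in favour of `st.upper t ∪ N`. -/
def rejected (N : Finset V) : Finset V :=
  (st.offered S t \ N).filter fun e => !O 1 (insert e (st.upper t ∪ N))

/-- The solution after `N` has been accepted. -/
noncomputable def nextSolution (N : Finset V) : Finset V :=
  greedy (O 1) (descList (S.filter fun e => e ∈ st.I ∧ st.lev e < t) st.lev) (st.upper t ∪ N)

/-- The part of the basis up to level `t` after `N` has been accepted and `R` rejected. -/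
noncomputable def nextLower (N R : Finset V) : Finset V :=
  greedy (O 0) R.toList (st.lower t ∪ N)

/-- One auction step at level `t`: accept what both matroids admit and raise the level of what the
second matroid rejects. -/
noncomputable def step : LevelState V where
  lev e := if e ∈ st.rejected O S t (st.accepted O S t) then st.lev e + 1 else st.lev e
  I := st.nextSolution O S t (st.accepted O S t)
  D := st.nextLower O t (st.accepted O S t) (st.rejected O S t (st.accepted O S t)) ∪
    st.D.filter fun e => t < st.lev e

/-- Acceptance asks both matroids; rejection and the two refills ask one query per element, hence `2
+ 1 + 1 + 1`. -/
theorem queryComputable_step : QueryComputable (5 * S.card) fun O => st.step O S t := by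
  have hoff : (st.offered S t).card ≤ S.card := card_filter_le _ _
  have hN : QueryComputable (S.card * 2) fun O => st.accepted O S t := by
    refine (QueryComputable.greedy (q := 2) (fun Y => ?_) _ _).mono
      (Nat.mul_le_mul_right 2 ?_)
    · exact (QueryComputable.ask 1 (st.upper t ∪ Y)).bind fun a =>
        (QueryComputable.ask 0 (st.lower t ∪ Y)).map fun b => a && b
    · simpa using hoff
  have hR : ∀ N, QueryComputable S.card fun O => st.rejected O S t N := fun N =>
    (QueryComputable.filter (q := 1)
      (fun e => (QueryComputable.ask 1 (insert e (st.upper t ∪ N))).map (!·)) _).mono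
      (by simpa using (card_le_card sdiff_subset).trans hoff)
  have hI : ∀ N, QueryComputable S.card fun O => st.nextSolution O S t N := fun N =>
    (QueryComputable.greedy (q := 1) (fun Y => QueryComputable.ask 1 Y) _ _).mono
      (by simpa [length_descList] using card_filter_le _ _)
  have hD : ∀ N R, R ⊆ S → QueryComputable S.card fun O => st.nextLower O t N R := fun N R hRS =>
    (QueryComputable.greedy (q := 1) (fun Y => QueryComputable.ask 0 Y) _ _).mono
      (by simpa using card_le_card hRS)
  have hRS : ∀ O N, st.rejected O S t N ⊆ S := fun O N =>
    (filter_subset _ _).trans (sdiff_subset.trans (filter_subset _ _))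
  have hD' : ∀ N R, QueryComputable S.card fun O => st.nextLower O t N (R ∩ S) := fun N R =>
    hD N _ inter_subset_right
  have := hN.bind fun N => (hR N).bind fun R => (hI N).bind fun I => (hD' N R).map fun Z =>
    (⟨fun e => if e ∈ R then st.lev e + 1 else st.lev e, I,
      Z ∪ st.D.filter fun e => t < st.lev e⟩ : LevelState V)
  refine (cast (congrArg _ (funext fun O => ?_)) this).mono (by omega)
  simp only [step, inter_eq_left.2 (hRS O _)]

/-- The invariant of the auction on the set `S`. -/
structure Invariant (M : Fin 2 → Matroid V) (S : Finset V) (st : LevelState V) : Prop where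
  I_subset_D : st.I ⊆ st.D
  D_subset : st.D ⊆ S
  D_indep : (M 0).Indep (st.D : Set V)
  I_indep : (M 1).Indep (st.I : Set V)
  low : ∀ s, ∀ e ∈ S, st.lev e ≤ s →
    e ∈ (M 0).closure ((st.D.filter fun x => st.lev x ≤ s : Finset V) : Set V)
  high : ∀ s, ∀ e ∈ S, s < st.lev e →
    e ∈ (M 1).closure ((st.I.filter fun x => s ≤ st.lev x : Finset V) : Set V)

variable {O S t st} {M : Fin 2 → Matroid V}

/-- A step keeps the invariant. No low part of `D` grows, no high part of `I` shrinks, and both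
together gain the number of elements of `D` at level `t` that are not in `I`. -/
theorem Invariant.step (hE : ∀ i, (M i).E = Set.univ) (h : st.Invariant M S) (t : ℕ) :
    let st' := st.step (indepOracle M) S t
    st'.Invariant M S ∧
    (∀ s, (st'.D.filter fun x => st'.lev x ≤ s).card ≤ (st.D.filter fun x => st.lev x ≤ s).card) ∧
    (∀ s, (st.I.filter fun x => s ≤ st.lev x).card ≤ (st'.I.filter fun x => s ≤ st'.lev x).card) ∧
    (st'.D.filter fun x => st'.lev x ≤ t).card + (st.D.filter fun x => st.lev x = t).card
        + (st.I.filter fun x => t ≤ st.lev x).card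
      ≤ (st.D.filter fun x => st.lev x ≤ t).card + (st.I.filter fun x => st.lev x = t).card
        + (st'.I.filter fun x => t ≤ st'.lev x).card := by
  intro st'
  set N := st.accepted (indepOracle M) S t with hN
  set R := st.rejected (indepOracle M) S t N with hR
  set X := st.lower t with hX
  set Y := st.upper t with hY
  set Z := st.nextLower (indepOracle M) t N R with hZ
  have hI' : st'.I = st.nextSolution (indepOracle M) S t N := rfl
  have hD' : st'.D = Z ∪ st.D.filter fun e => t < st.lev e := rfl
  have hlev' : ∀ e, st'.lev e = if e ∈ R then st.lev e + 1 else st.lev e := fun e => rfl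
  have hIS := h.I_subset_D.trans h.D_subset
  have memX : ∀ e, e ∈ X ↔ (e ∈ st.D ∧ st.lev e < t) ∨ (e ∈ st.I ∧ st.lev e = t) := fun e => by
    simp [hX, lower]
  have memY : ∀ e, e ∈ Y ↔ e ∈ st.I ∧ t ≤ st.lev e := fun e => by simp [hY, upper]
  have memN : ∀ e ∈ N, e ∈ S ∧ st.lev e = t ∧ e ∉ st.I := fun e he => by
    have := mem_of_mem_greedy he
    simpa [offered] using this
  have memR : ∀ e, e ∈ R ↔ (e ∈ S ∧ st.lev e = t ∧ e ∉ st.I ∧ e ∉ N) ∧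
      ¬ (M 1).Indep ((insert e (Y ∪ N) : Finset V) : Set V) := fun e => by
    simp only [hR, rejected, mem_filter, mem_sdiff, offered, Bool.not_eq_true',
      ← Bool.not_eq_true, indepOracle_iff]
    tauto
  have hXD : X ⊆ st.D := fun e he => by
    rcases (memX e).1 he with h1 | h1
    · exact h1.1
    · exact h.I_subset_D h1.1
  have hNind : (M 1).Indep ((Y ∪ N : Finset V) : Set V) ∧
      (M 0).Indep ((X ∪ N : Finset V) : Set V) := by
    have : (fun N : Finset V => indepOracle M 1 (Y ∪ N) && indepOracle M 0 (X ∪ N)) N = true := by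
      refine ind_greedy
        (ind := fun N : Finset V => indepOracle M 1 (Y ∪ N) && indepOracle M 0 (X ∪ N)) ?_
      simp only [union_empty, Bool.and_eq_true, indepOracle_iff]
      exact ⟨h.I_indep.subset (by exact_mod_cast filter_subset _ _),
        h.D_indep.subset (by exact_mod_cast hXD)⟩
    simpa only [Bool.and_eq_true, indepOracle_iff] using this
  have hRcl : ∀ e ∈ R, e ∈ (M 1).closure ((Y ∪ N : Finset V) : Set V) := fun e he =>
    hNind.1.mem_closure_of_not_indep_insert (hE 1) (by simpa using ((memR e).1 he).2)
  -- An offered element that is neither accepted nor rejected passes the second matroid's test, so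
  -- the first matroid must have blocked it.
  have hskip : ∀ e ∈ S, st.lev e = t → e ∉ R →
      e ∈ (M 0).closure ((X ∪ N : Finset V) : Set V) := by
    intro e heS het heR
    have hsub := (M 0).subset_closure ((X ∪ N : Finset V) : Set V) (by simp [hE])
    by_cases heI : e ∈ st.I
    · exact hsub (mem_coe.2 (mem_union_left _ ((memX e).2 (Or.inr ⟨heI, het⟩))))
    by_cases heN : e ∈ N
    · exact hsub (mem_coe.2 (mem_union_right _ heN))
    have h1 : (M 1).Indep ((insert e (Y ∪ N) : Finset V) : Set V) := by
      by_contra hcon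
      exact heR ((memR e).2 ⟨⟨heS, het, heI, heN⟩, hcon⟩)
    refine hNind.2.mem_closure_of_not_indep_insert (hE 0) fun hcon => ?_
    refine not_ind_insert_greedy
      (ind := fun N : Finset V => indepOracle M 1 (Y ∪ N) && indepOracle M 0 (X ∪ N))
      (fun A B hAB hB => ?_) (l := (st.offered S t).toList) (X := ∅)
      (by simp [offered, heS, het, heI]) heN ?_
    · simp only [Bool.and_eq_true] at hB ⊢
      exact ⟨indepOracle_mono _ _ (union_subset_union_right hAB) hB.1,
        indepOracle_mono _ _ (union_subset_union_right hAB) hB.2⟩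
    · simp only [Bool.and_eq_true, indepOracle_iff]
      change (M 1).Indep ((Y ∪ insert e N : Finset V) : Set V) ∧
        (M 0).Indep ((X ∪ insert e N : Finset V) : Set V)
      rw [union_insert, union_insert]
      exact ⟨h1, by simpa using hcon⟩
  have hZind : (M 0).Indep (Z : Set V) :=
    indepOracle_iff.1 (ind_greedy (indepOracle_iff.2 hNind.2))
  have hXNZ : X ∪ N ⊆ Z := subset_greedy
  have memZ : ∀ e ∈ Z, e ∈ X ∪ N ∨ e ∈ R := fun e he => by
    have := mem_of_mem_greedy he
    simpa using this
  have hRZ : ∀ e ∈ R, e ∈ (M 0).closure (Z : Set V) := fun e he => by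
    by_cases heZ : e ∈ Z
    · exact (M 0).subset_closure (Z : Set V) (by simp [hE]) heZ
    · refine hZind.mem_closure_of_not_indep_insert (hE 0) ?_
      have := not_ind_insert_greedy (ind := indepOracle M 0) indepOracle_mono
        (mem_toList.2 he) heZ
      rw [indepOracle_iff] at this
      rw [← coe_insert]
      exact this
  have hZS : ∀ e ∈ Z, e ∈ S ∧ st.lev e ≤ t := fun e he => by
    rcases memZ e he with h1 | h1
    · rcases mem_union.1 h1 with h2 | h2
      · refine ⟨h.D_subset (hXD h2), ?_⟩
        rcases (memX e).1 h2 with h3 | h3 <;> omega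
      · exact ⟨(memN e h2).1, (memN e h2).2.1.le⟩
    · exact ⟨((memR e).1 h1).1.1, ((memR e).1 h1).1.2.1.le⟩
  have hlevle : ∀ e, st.lev e ≤ st'.lev e := fun e => by rw [hlev']; split_ifs <;> omega
  have hlevR : ∀ e, e ∉ R → st'.lev e = st.lev e := fun e he => by rw [hlev', if_neg he]
  have hlevR' : ∀ e ∈ R, st'.lev e = t + 1 := fun e he => by
    rw [hlev', if_pos he, ((memR e).1 he).1.2.1]
  have hRt : ∀ e, st.lev e ≠ t → e ∉ R := fun e he hc => he ((memR e).1 hc).1.2.1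
  have hRI : ∀ e ∈ st.I, e ∉ R := fun e he hc => ((memR e).1 hc).1.2.2.1 he
  have hRN : ∀ e ∈ N, e ∉ R := fun e he hc => ((memR e).1 hc).1.2.2.2 he
  have hRX : ∀ e ∈ X, e ∉ R := fun e he => by
    rcases (memX e).1 he with h1 | h1
    · exact hRt e (by omega)
    · exact hRI e h1.1
  have hD'S : st'.D ⊆ S := fun e he => by
    rcases mem_union.1 (hD' ▸ he) with h1 | h1
    · exact (hZS e h1).1
    · exact h.D_subset (mem_filter.1 h1).1
  have hD'ind : (M 0).Indep (st'.D : Set V) := by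
    rw [hD']
    -- `Z` is spanned by the old basis up to level `t`, so it can replace that part beneath the
    -- higher levels.
    refine Matroid.Indep.union_of_subset_closure (hE 0) hZind
      (Y := st.D.filter fun e => st.lev e ≤ t)
      (fun e he => h.low t e (hZS e he).1 (hZS e he).2) ?_ ?_
    · refine h.D_indep.subset ?_
      exact_mod_cast union_subset (filter_subset _ _) (filter_subset _ _)
    · rw [disjoint_left]
      intro e h1 h2
      have := (mem_filter.1 h1).2
      have := (mem_filter.1 h2).2
      omega
  have hXD' : X ∪ N ⊆ st'.D := hXNZ.trans (hD' ▸ subset_union_left)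
  have hcl0 : ∀ {A B : Finset V}, (∀ x ∈ A, x ∈ (M 0).closure (B : Set V)) →
      ∀ e ∈ (M 0).closure (A : Set V), e ∈ (M 0).closure (B : Set V) := fun hAB e he =>
    (M 0).closure_subset_closure_of_subset_closure hAB he
  have hcl1 : ∀ {A B : Finset V}, (∀ x ∈ A, x ∈ (M 1).closure (B : Set V)) →
      ∀ e ∈ (M 1).closure (A : Set V), e ∈ (M 1).closure (B : Set V) := fun hAB e he =>
    (M 1).closure_subset_closure_of_subset_closure hAB he
  have hmem : ∀ i {B : Finset V}, ∀ x ∈ B, x ∈ (M i).closure (B : Set V) := fun i B x hx =>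
    (M i).subset_closure (B : Set V) (by simp [hE]) hx
  have hlow' : ∀ s, ∀ e ∈ S, st'.lev e ≤ s →
      e ∈ (M 0).closure ((st'.D.filter fun x => st'.lev x ≤ s : Finset V) : Set V) := by
    intro s e heS hes
    have hes' := (hlevle e).trans hes
    rcases lt_trichotomy s t with hst | rfl | hst
    · refine hcl0 (fun x hx => hmem 0 x ?_) e (h.low s e heS hes')
      rw [mem_filter] at hx ⊢
      refine ⟨hXD' (mem_union_left _ ((memX x).2 (Or.inl ⟨hx.1, by omega⟩))), ?_⟩
      rw [hlevR x (hRt x (by omega))]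
      exact hx.2
    · have heR : e ∉ R := fun hc => by
        have := hlevR' e hc
        omega
      have h1 : e ∈ (M 0).closure ((X ∪ N : Finset V) : Set V) := by
        rcases hes'.lt_or_eq with h2 | h2
        · refine hcl0 (fun x hx => hmem 0 x ?_) e (h.low (st.lev e) e heS le_rfl)
          rw [mem_filter] at hx
          exact mem_union_left _ ((memX x).2 (Or.inl ⟨hx.1, by omega⟩))
        · exact hskip e heS h2 heR
      refine hcl0 (fun x hx => hmem 0 x (mem_filter.2 ⟨hXD' hx, ?_⟩)) e h1
      rw [hlevR x (by rcases mem_union.1 hx with h2 | h2; exacts [hRX x h2, hRN x h2])]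
      exact (hZS x (hXNZ hx)).2
    · refine hcl0 (fun x hx => ?_) e (h.low s e heS hes')
      rw [mem_filter] at hx
      -- Raised elements reach level `t + 1`, which is still at most `s`.
      have hZle : ∀ z ∈ Z, z ∈ st'.D.filter fun x => st'.lev x ≤ s := fun z hz => by
        refine mem_filter.2 ⟨hD' ▸ mem_union_left _ hz, ?_⟩
        have := (hZS z hz).2
        rw [hlev']
        split_ifs <;> omega
      rcases lt_trichotomy (st.lev x) t with h1 | h1 | h1
      · exact hmem 0 x (hZle x (hXNZ (mem_union_left _ ((memX x).2 (Or.inl ⟨hx.1, h1⟩)))))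
      · have hxZ : x ∈ (M 0).closure (Z : Set V) := by
          by_cases hxR : x ∈ R
          · exact hRZ x hxR
          · exact hcl0 (fun y hy => hmem 0 y (hXNZ hy)) x (hskip x (h.D_subset hx.1) h1 hxR)
        exact hcl0 (fun z hz => hmem 0 z (hZle z hz)) x hxZ
      · refine hmem 0 x (mem_filter.2 ⟨hD' ▸ mem_union_right _ (mem_filter.2 ⟨hx.1, h1⟩), ?_⟩)
        rw [hlevR x (hRt x (by omega))]
        exact hx.2
  have hI'ind : (M 1).Indep (st'.I : Set V) :=
    indepOracle_iff.1 (ind_greedy (indepOracle_iff.2 hNind.1))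
  have hYNI' : Y ∪ N ⊆ st'.I := subset_greedy
  have memI' : ∀ e ∈ st'.I, e ∈ Y ∪ N ∨ (e ∈ st.I ∧ st.lev e < t) := fun e he => by
    have := mem_of_mem_greedy he
    rw [mem_descList, mem_filter] at this
    exact this.imp id And.right
  have hI'D' : st'.I ⊆ st'.D := fun e he => by
    have hcase : e ∈ st.I ∨ e ∈ N := by
      rcases memI' e he with h1 | h1
      · rcases mem_union.1 h1 with h2 | h2
        · exact Or.inl ((memY e).1 h2).1
        · exact Or.inr h2
      · exact Or.inl h1.1
    rcases hcase with h1 | h1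
    · rcases lt_trichotomy (st.lev e) t with h2 | h2 | h2
      · exact hXD' (mem_union_left _ ((memX e).2 (Or.inl ⟨h.I_subset_D h1, h2⟩)))
      · exact hXD' (mem_union_left _ ((memX e).2 (Or.inr ⟨h1, h2⟩)))
      · exact hD' ▸ mem_union_right _ (mem_filter.2 ⟨h.I_subset_D h1, h2⟩)
    · exact hXD' (mem_union_right _ h1)
  have hIcl : ∀ s, ∀ x ∈ st.I.filter fun x => s ≤ st.lev x,
      x ∈ (M 1).closure ((st'.I.filter fun x => s ≤ st'.lev x : Finset V) : Set V) := by
    intro s x hx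
    rw [mem_filter] at hx
    by_cases hxI : x ∈ st'.I
    · exact hmem 1 x (mem_filter.2 ⟨hxI, hx.2.trans (hlevle x)⟩)
    have hxt : st.lev x < t := by
      by_contra hc
      exact hxI (hYNI' (mem_union_left _ ((memY x).2 ⟨hx.1, by omega⟩)))
    -- The refill runs by decreasing level, so a dropped element is spanned by survivors of at least
    -- its own level.
    have h1 := not_ind_insert_greedy_filter (ind := indepOracle M 1) indepOracle_mono st.lev
      (pairwise_descList (S.filter fun e => e ∈ st.I ∧ st.lev e < t) st.lev)
      (X := Y ∪ N) (fun y hy e he => by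
        rw [mem_descList, mem_filter] at he
        rcases mem_union.1 hy with h2 | h2
        · have := ((memY y).1 h2).2
          omega
        · have := (memN y h2).2.1
          omega)
      (mem_descList.2 (mem_filter.2 ⟨hIS hx.1, hx.1, hxt⟩)) hxI
    rw [indepOracle_iff, coe_insert] at h1
    have h2 := (hI'ind.subset (by exact_mod_cast filter_subset _ _)
      ).mem_closure_of_not_indep_insert (hE 1) h1
    refine hcl1 (fun y hy => hmem 1 y ?_) x h2
    have hy' : y ∈ st'.I ∧ st.lev x ≤ st.lev y := mem_filter.1 hy
    exact mem_filter.2 ⟨hy'.1, hx.2.trans (hy'.2.trans (hlevle y))⟩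
  have hYNle : Y ∪ N ⊆ st'.I.filter fun x => t ≤ st'.lev x := fun x hx => by
    refine mem_filter.2 ⟨hYNI' hx, le_trans ?_ (hlevle x)⟩
    rcases mem_union.1 hx with h2 | h2
    · exact ((memY x).1 h2).2
    · exact (memN x h2).2.1.ge
  have hhigh' : ∀ s, ∀ e ∈ S, s < st'.lev e →
      e ∈ (M 1).closure ((st'.I.filter fun x => s ≤ st'.lev x : Finset V) : Set V) := by
    intro s e heS hes
    by_cases h1 : s < st.lev e
    · exact hcl1 (hIcl s) e (h.high s e heS h1)
    -- The only new case: `e` has just been raised past `s = t`, and its rejection means that `Y ∪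
    -- N` spans it.
    have heR : e ∈ R := by
      by_contra hc
      rw [hlevR e hc] at hes
      exact h1 hes
    have := hlevR' e heR
    have := ((memR e).1 heR).1.2.1
    obtain rfl : s = t := by omega
    exact hcl1 (fun x hx => hmem 1 x (hYNle hx)) e (hRcl e heR)
  refine ⟨⟨hI'D', hD'S, hD'ind, hI'ind, hlow', hhigh'⟩, fun s => ?_, fun s => ?_, ?_⟩
  · refine (hD'ind.subset ?_).card_le_of_subset_closure (M := M 0) fun e he => ?_
    · exact_mod_cast filter_subset _ _
    · have := mem_filter.1 (mem_coe.1 he)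
      exact h.low s e (hD'S this.1) ((hlevle e).trans this.2)
  · refine (h.I_indep.subset ?_).card_le_of_subset_closure (M := M 1) (hIcl s)
    exact_mod_cast filter_subset _ _
  -- Members of `R` have left level `t`. So at level `t` the basis keeps at most the old solution
  -- and `N`, while the upper solution gains all of `N`; the contributions of `N` cancel.
  · have h1 : (st'.D.filter fun x => st'.lev x ≤ t) ⊆ X ∪ N := fun e he => by
      rw [mem_filter, hD', mem_union] at he
      obtain ⟨h2 | h2, h3⟩ := he
      · refine (memZ e h2).resolve_right fun hc => ?_
        have := hlevR' e hc
        omega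
      · have := (mem_filter.1 h2).2
        have := hlevle e
        omega
    have h2 := (card_le_card h1).trans ((card_union_le X N).trans
      (Nat.add_le_add_right (card_union_le _ _) _))
    have h3 : (Y ∪ N).card = Y.card + N.card := card_union_of_disjoint
      (disjoint_left.2 fun e hY hN => (memN e hN).2.2 ((memY e).1 hY).1)
    have h4 := card_le_card hYNle
    have h5 : (st.D.filter fun x => st.lev x ≤ t).card
        = (st.D.filter fun x => st.lev x < t).card + (st.D.filter fun x => st.lev x = t).card := by
      rw [← card_union_of_disjoint (disjoint_filter.2 fun _ _ _ _ => by omega), ← filter_or]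
      congr 1
      exact filter_congr fun _ _ => by omega
    have h6 : Y = st.I.filter fun x => t ≤ st.lev x := rfl
    rw [← h6]
    omega

end LevelState

end LevelAlgorithm

/-! ### Termination of the auction and its dual certificate. -/

section AuctionRun

variable {V : Type u}

theorem card_filter_level_lt (F : Finset V) (lev : V → ℕ) (m : ℕ) :
    (F.filter fun e => lev e < m).card = ∑ s ∈ range m, (F.filter fun e => lev e = s).card := by
  classical
  induction m with
  | zero => simp
  | succ m ih =>
    rw [sum_range_succ, ← ih, ← card_union_of_disjoint (disjoint_filter.2 fun _ _ _ _ => by omega),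
      ← filter_or]
    congr 1
    exact filter_congr fun _ _ => by omega

namespace LevelState

variable [DecidableEq V]

/-- At level `t` the basis has at least `k / L ^ 2` elements outside the solution. -/
def Unbalanced (L k t : ℕ) (st : LevelState V) : Prop :=
  L ^ 2 * (st.I.filter fun e => st.lev e = t).card + k
    ≤ L ^ 2 * (st.D.filter fun e => st.lev e = t).card

/-- The state before the auction. -/
noncomputable def init (O : Fin 2 → Finset V → Bool) (S : Finset V) : LevelState V :=
  ⟨fun _ => 0, ∅, greedy (O 0) (descList S fun _ => 0) ∅⟩

open Classical in
/-- Make a step at an unbalanced level, if there is one. -/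
noncomputable def advance (O : Fin 2 → Finset V → Bool) (S : Finset V) (L k : ℕ)
    (st : LevelState V) : LevelState V :=
  if h : ∃ t < L, st.Unbalanced L k t then st.step O S h.choose else st

open Classical in
/-- Read off the solution and a dual solution. -/
noncomputable def result (L k : ℕ) (st : LevelState V) : Finset V × Finset V × Finset V :=
  if h : ∃ t, L * ((st.D.filter fun e => st.lev e ≤ t).card
      + (st.I.filter fun e => t ≤ st.lev e).card) ≤ L * st.I.card + st.I.card + k
  then (st.I, st.D.filter fun e => st.lev e ≤ h.choose, st.I.filter fun e => h.choose ≤ st.lev e)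
  -- Never reached from a balanced state with `0 < L`, by `exists_dual_of_balanced`.
  else (st.I, ∅, ∅)

/-- The potential that decreases in every step of the auction. -/
def potential (L : ℕ) (st : LevelState V) : ℤ :=
  ∑ s ∈ range L, (((st.D.filter fun e => st.lev e ≤ s).card : ℤ)
    - (st.I.filter fun e => s ≤ st.lev e).card)

variable {M : Fin 2 → Matroid V} {S : Finset V} {st : LevelState V} {L k t : ℕ}

theorem invariant_init (hE : ∀ i, (M i).E = Set.univ) (S : Finset V) :
    (init (indepOracle M) S).Invariant M S := by
  have hD : (M 0).Indep ((init (indepOracle M) S).D : Set V) :=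
    indepOracle_iff.1 (ind_greedy (indepOracle_iff.2 (by simp)))
  refine ⟨empty_subset _, fun e he => ?_, hD, by simp [init], fun s e he _ => ?_, fun s e _ h => ?_⟩
  · have := mem_of_mem_greedy he
    simpa [mem_descList] using this
  · have hfil : ((init (indepOracle M) S).D.filter fun x => (init (indepOracle M) S).lev x ≤ s)
        = (init (indepOracle M) S).D := filter_true_of_mem fun _ _ => Nat.zero_le s
    rw [hfil]
    by_cases heD : e ∈ (init (indepOracle M) S).D
    · exact (M 0).subset_closure _ (by simp [hE]) (mem_coe.2 heD)
    · refine hD.mem_closure_of_not_indep_insert (hE 0) ?_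
      have := not_ind_insert_greedy (ind := indepOracle M 0) indepOracle_mono
        (mem_descList.2 he) heD
      rw [indepOracle_iff, coe_insert] at this
      exact this
  · exact absurd h (Nat.not_lt_zero _)

/-- The summand at `t` supplies the whole decrease; monotonicity of low and high parts keeps the
others from growing. -/
theorem Invariant.potential_step (hE : ∀ i, (M i).E = Set.univ) (h : st.Invariant M S)
    (ht : t < L) :
    (st.step (indepOracle M) S t).potential L + (st.D.filter fun e => st.lev e = t).card
      ≤ st.potential L + (st.I.filter fun e => st.lev e = t).card := by
  obtain ⟨-, hD, hI, hgain⟩ := h.step hE t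
  have htL : t ∈ range L := mem_range.2 ht
  unfold potential
  rw [← add_sum_erase _ _ htL, ← add_sum_erase (range L) _ htL]
  have hrest := sum_le_sum (s := (range L).erase t) fun s _ =>
    sub_le_sub (Int.ofNat_le.2 (hD s)) (Int.ofNat_le.2 (hI s))
  have hgain' := Int.ofNat_le.2 hgain
  push_cast at hgain'
  linarith

theorem Invariant.advance (hE : ∀ i, (M i).E = Set.univ) (h : st.Invariant M S) :
    (st.advance (indepOracle M) S L k).Invariant M S := by
  unfold LevelState.advance
  split_ifs with hu
  · exact (h.step hE _).1
  · exact h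

theorem Invariant.iterate_advance (hE : ∀ i, (M i).E = Set.univ) (h : st.Invariant M S) (m : ℕ) :
    ((LevelState.advance (indepOracle M) S L k)^[m] st).Invariant M S := by
  induction m with
  | zero => exact h
  | succ m ih =>
    rw [Function.iterate_succ_apply']
    exact ih.advance hE

omit [DecidableEq V] in
theorem Invariant.card_D_le (hrank : ∀ Z : Finset V, (M 0).Indep (Z : Set V) → Z.card ≤ k)
    (h : st.Invariant M S) : st.D.card ≤ k :=
  hrank _ h.D_indep

omit [DecidableEq V] in
theorem Invariant.card_I_le (hrank : ∀ Z : Finset V, (M 0).Indep (Z : Set V) → Z.card ≤ k)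
    (h : st.Invariant M S) : st.I.card ≤ k :=
  (card_le_card h.I_subset_D).trans (h.card_D_le hrank)

/-- The potential lies between `-(L * k)` and `L * k`, and each unbalanced step costs it at least `k
/ L ^ 2`, so `2 * L ^ 3` steps are possible and one more is not. A balanced state is a fixed point
of `advance`. -/
theorem balanced_iterate_advance (hE : ∀ i, (M i).E = Set.univ)
    (hrank : ∀ Z : Finset V, (M 0).Indep (Z : Set V) → Z.card ≤ k) (hk : 0 < k) (S : Finset V) :
    ¬ ∃ t < L, ((LevelState.advance (indepOracle M) S L k)^[2 * L ^ 3 + 1]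
      (init (indepOracle M) S)).Unbalanced L k t := by
  have key : ∀ m, (¬ ∃ t < L, ((LevelState.advance (indepOracle M) S L k)^[m]
      (init (indepOracle M) S)).Unbalanced L k t) ∨
      (L : ℤ) ^ 2 * ((LevelState.advance (indepOracle M) S L k)^[m]
        (init (indepOracle M) S)).potential L + m * k ≤ L ^ 3 * k := by
    intro m
    induction m with
    | zero =>
      right
      have hpot : (init (indepOracle M) S).potential L ≤ L * k := by
        have h1 := (invariant_init hE S).card_D_le hrank
        calc (init (indepOracle M) S).potential L ≤ ∑ s ∈ range L, (k : ℤ) := by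
              refine sum_le_sum fun s _ => ?_
              have := (card_filter_le (init (indepOracle M) S).D
                fun e => (init (indepOracle M) S).lev e ≤ s).trans h1
              omega
          _ = L * k := by simp
      have := mul_le_mul_of_nonneg_left hpot (sq_nonneg (L : ℤ))
      simp only [Function.iterate_zero, id]
      push_cast
      linarith [show (L : ℤ) ^ 2 * (L * k) = L ^ 3 * k by ring]
    | succ m ih =>
      rw [Function.iterate_succ_apply']
      set st := (LevelState.advance (indepOracle M) S L k)^[m] (init (indepOracle M) S)
      have hst : st.Invariant M S := (invariant_init hE S).iterate_advance hE m
      by_cases hu : ∃ t < L, st.Unbalanced L k t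
      · right
        replace ih := ih.resolve_left (not_not.2 hu)
        rw [LevelState.advance, dif_pos hu]
        have h1 := hst.potential_step hE hu.choose_spec.1
        have h2 : (L ^ 2 * (st.I.filter fun e => st.lev e = hu.choose).card + k : ℤ)
          ≤ L ^ 2 * (st.D.filter fun e => st.lev e = hu.choose).card := by
          exact_mod_cast hu.choose_spec.2
        have := mul_le_mul_of_nonneg_left h1 (sq_nonneg (L : ℤ))
        push_cast
        linarith
      · left
        rwa [LevelState.advance, dif_neg hu]
  refine (key (2 * L ^ 3 + 1)).resolve_right fun hcon => ?_
  set st := (LevelState.advance (indepOracle M) S L k)^[2 * L ^ 3 + 1] (init (indepOracle M) S)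
  have hst : st.Invariant M S := (invariant_init hE S).iterate_advance hE _
  have hpot : -(L * k : ℤ) ≤ st.potential L := by
    have h1 := hst.card_I_le hrank
    calc -(L * k : ℤ) = ∑ s ∈ range L, -(k : ℤ) := by simp
      _ ≤ st.potential L := by
        refine sum_le_sum fun s _ => ?_
        have := (card_filter_le st.I fun e => s ≤ st.lev e).trans h1
        omega
  have := mul_le_mul_of_nonneg_left hpot (sq_nonneg (L : ℤ))
  push_cast at hcon
  have hk' : (0 : ℤ) < k := by exact_mod_cast hk
  linarith [show (L : ℤ) ^ 2 * -(L * k) = -(L ^ 3 * k) by ring]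

/-- By averaging, some level `t < L` holds at most `|I| / L` of the solution, the overlap of the two
thresholds. The at most `L` gaps of `k / L ^ 2` up to `t` add up to at most `k / L`. -/
theorem exists_dual_of_balanced (hL : 0 < L) (h : ¬ ∃ t < L, st.Unbalanced L k t) :
    ∃ t, L * ((st.D.filter fun e => st.lev e ≤ t).card
      + (st.I.filter fun e => t ≤ st.lev e).card) ≤ L * st.I.card + st.I.card + k := by
  obtain ⟨t, ht, hIt⟩ : ∃ t < L, L * (st.I.filter fun e => st.lev e = t).card ≤ st.I.card := by
    by_contra! hcon
    have h1 := sum_lt_sum_of_nonempty (s := range L) (by simpa using hL.ne')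
      fun t ht => hcon t (mem_range.1 ht)
    rw [← mul_sum, ← card_filter_level_lt, sum_const, card_range, smul_eq_mul] at h1
    have := Nat.mul_le_mul_left L (card_filter_le st.I fun e => st.lev e < L)
    omega
  refine ⟨t, ?_⟩
  have hD : (st.D.filter fun e => st.lev e ≤ t).card
      = ∑ s ∈ range (t + 1), (st.D.filter fun e => st.lev e = s).card := by
    rw [← card_filter_level_lt]
    congr 1
    exact filter_congr fun _ _ => by omega
  have hI : (st.I.filter fun e => st.lev e ≤ t).card
      = ∑ s ∈ range (t + 1), (st.I.filter fun e => st.lev e = s).card := by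
    rw [← card_filter_level_lt]
    congr 1
    exact filter_congr fun _ _ => by omega
  have hbal : L ^ 2 * (st.D.filter fun e => st.lev e ≤ t).card
      ≤ L ^ 2 * (st.I.filter fun e => st.lev e ≤ t).card + L * k := by
    rw [hD, hI, mul_sum, mul_sum]
    calc ∑ s ∈ range (t + 1), L ^ 2 * (st.D.filter fun e => st.lev e = s).card
        ≤ ∑ s ∈ range (t + 1), (L ^ 2 * (st.I.filter fun e => st.lev e = s).card + k) := by
          refine sum_le_sum fun s hs => ?_
          by_contra hc
          refine h ⟨s, by rw [mem_range] at hs; omega, ?_⟩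
          unfold Unbalanced
          omega
      _ ≤ _ := by
          rw [sum_add_distrib, sum_const, card_range, smul_eq_mul]
          have := Nat.mul_le_mul_right k (show t + 1 ≤ L by omega)
          omega
  have hbal' : L * (st.D.filter fun e => st.lev e ≤ t).card
      ≤ L * (st.I.filter fun e => st.lev e ≤ t).card + k := by
    refine Nat.le_of_mul_le_mul_left ?_ hL
    linarith [hbal, sq L, show L ^ 2 * (st.D.filter fun e => st.lev e ≤ t).card
      = L * (L * (st.D.filter fun e => st.lev e ≤ t).card) by ring,
      show L ^ 2 * (st.I.filter fun e => st.lev e ≤ t).card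
      = L * (L * (st.I.filter fun e => st.lev e ≤ t).card) by ring]
  have hsplit : (st.I.filter fun e => st.lev e ≤ t).card + (st.I.filter fun e => t ≤ st.lev e).card
      = st.I.card + (st.I.filter fun e => st.lev e = t).card := by
    rw [← card_union_add_card_inter, ← filter_or, ← filter_and]
    congr 2
    · exact filter_true_of_mem fun _ _ => le_total _ _
    · exact filter_congr fun _ _ => by omega
  have := congrArg (L * ·) hsplit
  simp only [mul_add] at this ⊢
  omega

end LevelState

variable [DecidableEq V]

/-- Approximate matroid intersection on `S`, given a bound `k` on the rank of the first matroid: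
the result is a common independent set together with a dual solution. -/
noncomputable def auction (O : Fin 2 → Finset V → Bool) (S : Finset V) (L k : ℕ) :
    Finset V × Finset V × Finset V :=
  ((LevelState.advance O S L k)^[2 * L ^ 3 + 1] (LevelState.init O S)).result L k

theorem queryComputable_auction (S : Finset V) {L : ℕ} (hL : 0 < L) (k : ℕ) :
    QueryComputable (16 * L ^ 3 * S.card) fun O => auction O S L k := by
  have hinit : QueryComputable S.card fun O => LevelState.init O S :=
    ((QueryComputable.greedy (q := 1) (fun Y => QueryComputable.ask 0 Y) _ _).map
      fun D => (⟨fun _ => 0, ∅, D⟩ : LevelState V)).mono (by simp [length_descList])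
  have hadv : ∀ st, QueryComputable (5 * S.card) fun O => LevelState.advance O S L k st := by
    intro st
    unfold LevelState.advance
    split_ifs with h
    · exact st.queryComputable_step S _
    · exact .const _ _
  have := (hinit.bind fun st => QueryComputable.iterate hadv (2 * L ^ 3 + 1) st).map
    (LevelState.result L k)
  refine this.mono ?_
  -- The cost is `1 + 5 * (2 * L ^ 3 + 1)` per element, at most `16 * L ^ 3`.
  have h3 : 1 ≤ L ^ 3 := Nat.one_le_pow _ _ hL
  nlinarith [Nat.zero_le S.card]

theorem auction_spec {M : Fin 2 → Matroid V} (hE : ∀ i, (M i).E = Set.univ) {k L : ℕ}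
    (hrank : ∀ Z : Finset V, (M 0).Indep (Z : Set V) → Z.card ≤ k) (hk : 0 < k) (hL : 0 < L)
    (S : Finset V) {I B₁ B₂ : Finset V} (h : auction (indepOracle M) S L k = (I, B₁, B₂)) :
    CommonIndep M I ∧ (M 0).Indep (B₁ : Set V) ∧ (M 1).Indep (B₂ : Set V) ∧ B₁.card ≤ k ∧
      B₂.card ≤ k ∧ I.card ≤ k ∧
      (∀ e ∈ S, e ∈ (M 0).closure B₁ ∨ e ∈ (M 1).closure B₂) ∧
      L * (B₁.card + B₂.card) ≤ L * I.card + I.card + k := by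
  unfold auction at h
  have hbal := LevelState.balanced_iterate_advance (L := L) hE hrank hk S
  set st := (LevelState.advance (indepOracle M) S L k)^[2 * L ^ 3 + 1]
    (LevelState.init (indepOracle M) S)
  have hst : st.Invariant M S := (LevelState.invariant_init hE S).iterate_advance hE _
  have hdual := LevelState.exists_dual_of_balanced hL hbal
  rw [LevelState.result, dif_pos hdual, Prod.mk.injEq, Prod.mk.injEq] at h
  obtain ⟨rfl, rfl, rfl⟩ := h
  have hD := filter_subset (fun e => st.lev e ≤ hdual.choose) st.D
  have hI := filter_subset (fun e => hdual.choose ≤ st.lev e) st.I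
  refine ⟨fun i => ?_, hst.D_indep.subset (by exact_mod_cast hD),
    hst.I_indep.subset (by exact_mod_cast hI), (card_le_card hD).trans (hst.card_D_le hrank),
    (card_le_card hI).trans (hst.card_I_le hrank), hst.card_I_le hrank, fun e he => ?_,
    hdual.choose_spec⟩
  · fin_cases i
    · exact hst.D_indep.subset (by exact_mod_cast hst.I_subset_D)
    · exact hst.I_indep
  · rcases le_or_gt (st.lev e) hdual.choose with h1 | h1
    · exact Or.inl (hst.low _ e he h1)
    · exact Or.inr (hst.high _ e he h1)

/-- The elements that are spanned neither by `B₁` in the first nor by `B₂` in the second matroid. -/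
def uncovered [Fintype V] (O : Fin 2 → Finset V → Bool) (B₁ B₂ : Finset V) : Finset V :=
  -- The membership test is needed because inserting an element already present keeps the set
  -- independent; it costs no query.
  univ.filter fun e => (O 0 (insert e B₁) && O 1 (insert e B₂)) && decide (e ∉ B₁ ∧ e ∉ B₂)

theorem queryComputable_uncovered [Fintype V] (B₁ B₂ : Finset V) :
    QueryComputable (Fintype.card V * 2) fun O => uncovered O B₁ B₂ :=
  QueryComputable.filter (q := 2) (fun e =>
    (QueryComputable.ask 0 (insert e B₁)).bind fun a =>
      (QueryComputable.ask 1 (insert e B₂)).map fun b => (a && b) && decide (e ∉ B₁ ∧ e ∉ B₂)) univ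

theorem mem_uncovered_iff [Fintype V] {M : Fin 2 → Matroid V} (hE : ∀ i, (M i).E = Set.univ)
    {B₁ B₂ : Finset V} (h₁ : (M 0).Indep (B₁ : Set V)) (h₂ : (M 1).Indep (B₂ : Set V)) {e : V} :
    e ∈ uncovered (indepOracle M) B₁ B₂ ↔ e ∉ (M 0).closure B₁ ∧ e ∉ (M 1).closure B₂ := by
  rw [h₁.notMem_closure_iff (by simp [hE]), h₂.notMem_closure_iff (by simp [hE])]
  simp only [uncovered, mem_filter, mem_univ, true_and, Bool.and_eq_true, indepOracle_iff,
    coe_insert, decide_eq_true_eq, mem_coe]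
  tauto

end AuctionRun

/-! ### Weighted sampling and the union bound. -/

section Sampling

variable {V : Type u} [Fintype V] [DecidableEq V]

/-- A sequence of `s` draws of elements of `V`, where `e` has weight `2 ^ cnt e`. -/
abbrev WeightedDraws (cnt : V → ℕ) (s : ℕ) : Type u := Fin s → Σ e : V, Fin (2 ^ cnt e)

/-- The set of elements that are drawn. -/
def WeightedDraws.support {cnt : V → ℕ} {s : ℕ} (ω : WeightedDraws cnt s) : Finset V :=
  univ.image fun i => (ω i).1

omit [Fintype V] in
theorem WeightedDraws.card_support_le {cnt : V → ℕ} {s : ℕ} (ω : WeightedDraws cnt s) :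
    ω.support.card ≤ s :=
  card_image_le.trans (by simp)

omit [DecidableEq V] in
theorem card_weightedDraws (cnt : V → ℕ) (s : ℕ) :
    Fintype.card (WeightedDraws cnt s) = (∑ e, 2 ^ cnt e) ^ s := by
  simp [WeightedDraws]

theorem card_draws_avoiding (cnt : V → ℕ) (s : ℕ) (U : Finset V) :
    (univ.filter fun ω : WeightedDraws cnt s => ∀ i, (ω i).1 ∉ U).card
      = (∑ e ∈ Uᶜ, 2 ^ cnt e) ^ s := by
  have h : (univ.filter fun ω : WeightedDraws cnt s => ∀ i, (ω i).1 ∉ U)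
      = Fintype.piFinset fun _ => Uᶜ.sigma fun e => (univ : Finset (Fin (2 ^ cnt e))) := by
    ext ω
    simp [Fintype.mem_piFinset]
  rw [h, Fintype.card_piFinset_const, card_sigma]
  simp

/-- A set of at most `k` elements can be listed in `k` slots, unused slots holding `none`. -/
theorem card_small_finsets_le (k : ℕ) :
    (univ.filter fun B : Finset V => B.card ≤ k).card ≤ (Fintype.card V + 1) ^ k := by
  have h : (univ.filter fun B : Finset V => B.card ≤ k)
      ⊆ univ.image fun f : Fin k → Option V => univ.filter fun v => ∃ i, f i = some v := by
    intro B hB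
    rw [mem_filter] at hB
    rw [mem_image]
    refine ⟨fun i => B.toList[(i : ℕ)]?, mem_univ _, ?_⟩
    ext v
    simp only [mem_filter, mem_univ, true_and]
    constructor
    · rintro ⟨i, hi⟩
      exact mem_toList.1 (List.mem_of_getElem? hi)
    · intro hv
      obtain ⟨i, hi, h⟩ := List.mem_iff_getElem.1 (mem_toList.2 hv)
      rw [length_toList] at hi
      refine ⟨⟨i, hi.trans_le hB.2⟩, ?_⟩
      rw [← h]
      exact List.getElem?_eq_getElem _
  refine (card_le_card h).trans (card_image_le.trans ?_)
  simp

/-- The draws that miss a heavy set among the sets `U B₁ B₂` with small `B₁` and `B₂`. -/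
def badDraws (cnt : V → ℕ) (s k : ℕ) (η : ℝ) (U : Finset V → Finset V → Finset V) :
    Set (WeightedDraws cnt s) :=
  {ω | ∃ B₁ B₂ : Finset V, B₁.card ≤ k ∧ B₂.card ≤ k ∧
    η * (∑ e, 2 ^ cnt e : ℕ) < (∑ e ∈ U B₁ B₂, 2 ^ cnt e : ℕ) ∧ ∀ i, (ω i).1 ∉ U B₁ B₂}

/-- A fixed set of relative weight above `η` is missed by at most a fraction `exp (-(η * s))` of the
draws. The certificate depends on the sample, so the bound is summed over all pairs of small sets.
-/
theorem ncard_badDraws_le (cnt : V → ℕ) (s k : ℕ) (η : ℝ)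
    (U : Finset V → Finset V → Finset V) :
    ((badDraws cnt s k η U).ncard : ℝ)
      ≤ ((Fintype.card V + 1 : ℕ) : ℝ) ^ (2 * k) * Real.exp (-(η * s)) *
        Fintype.card (WeightedDraws cnt s) := by
  classical
  set W : ℕ := ∑ e, 2 ^ cnt e with hW
  let P := ((univ.filter fun B : Finset V => B.card ≤ k) ×ˢ
    (univ.filter fun B : Finset V => B.card ≤ k)).filter fun p =>
      η * (W : ℝ) < (∑ e ∈ U p.1 p.2, 2 ^ cnt e : ℕ)
  let F : Finset V × Finset V → Finset (WeightedDraws cnt s) := fun p =>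
    univ.filter fun ω => ∀ i, (ω i).1 ∉ U p.1 p.2
  have hsub : badDraws cnt s k η U ⊆ (P.biUnion F : Finset (WeightedDraws cnt s)) := by
    rintro ω ⟨B₁, B₂, h1, h2, h3, h4⟩
    simp only [mem_coe, mem_biUnion]
    exact ⟨(B₁, B₂), by simp [P, h1, h2]; exact_mod_cast h3, by simpa [F] using h4⟩
  have hF : ∀ p ∈ P, ((F p).card : ℝ) ≤ Real.exp (-(η * s)) * (W : ℝ) ^ s := by
    intro p hp
    have hp' := (mem_filter.1 hp).2
    rw [card_draws_avoiding]
    have hsplit : (W : ℝ) = (∑ e ∈ U p.1 p.2, 2 ^ cnt e : ℕ) +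
        (∑ e ∈ (U p.1 p.2)ᶜ, 2 ^ cnt e : ℕ) := by
      rw [hW, ← sum_add_sum_compl (U p.1 p.2)]
      push_cast
      rfl
    have hle : ((∑ e ∈ (U p.1 p.2)ᶜ, 2 ^ cnt e : ℕ) : ℝ) ≤ Real.exp (-η) * W := by
      have h1 : ((∑ e ∈ (U p.1 p.2)ᶜ, 2 ^ cnt e : ℕ) : ℝ) ≤ (1 - η) * W := by linarith
      exact h1.trans (mul_le_mul_of_nonneg_right (Real.one_sub_le_exp_neg η) (Nat.cast_nonneg _))
    rw [Nat.cast_pow]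
    refine (pow_le_pow_left₀ (Nat.cast_nonneg _) hle s).trans (le_of_eq ?_)
    rw [mul_pow, ← Real.exp_nat_mul]
    congr 2
    ring
  have hP : (P.card : ℝ) ≤ ((Fintype.card V + 1 : ℕ) : ℝ) ^ (2 * k) := by
    have h1 : P.card ≤ (Fintype.card V + 1) ^ (2 * k) := by
      refine (card_filter_le _ _).trans ?_
      rw [card_product, two_mul, pow_add]
      exact Nat.mul_le_mul (card_small_finsets_le k) (card_small_finsets_le k)
    exact_mod_cast h1
  have hcard : (badDraws cnt s k η U).ncard ≤ ∑ p ∈ P, (F p).card := by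
    refine (Set.ncard_le_ncard hsub (Finset.finite_toSet _)).trans ?_
    rw [Set.ncard_coe_finset]
    exact card_biUnion_le
  calc ((badDraws cnt s k η U).ncard : ℝ) ≤ ∑ p ∈ P, ((F p).card : ℝ) := by exact_mod_cast hcard
    _ ≤ ∑ p ∈ P, Real.exp (-(η * s)) * (W : ℝ) ^ s := sum_le_sum hF
    _ = P.card * (Real.exp (-(η * s)) * (W : ℝ) ^ s) := by simp
    _ ≤ ((Fintype.card V + 1 : ℕ) : ℝ) ^ (2 * k) * (Real.exp (-(η * s)) * (W : ℝ) ^ s) :=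
        mul_le_mul_of_nonneg_right hP (by positivity)
    _ = _ := by rw [card_weightedDraws, ← hW]; push_cast; ring

end Sampling

/-! ### Multiplicative weights over the sampling rounds. -/

section Rounds

variable {V : Type u} [Fintype V] [DecidableEq V]

/-- One round: solve the sampled instance, count one more for every element that the dual solution
leaves uncovered, and keep the larger common independent set. -/
noncomputable def reweight (L k s : ℕ) (st : (V → ℕ) × Finset V) (ω : WeightedDraws st.1 s)
    (O : Fin 2 → Finset V → Bool) : (V → ℕ) × Finset V :=
  let R := auction O ω.support L k
  let U := uncovered O R.2.1 R.2.2
  (fun e => if e ∈ U then st.1 e + 1 else st.1 e, if st.2.card < R.1.card then R.1 else st.2)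

theorem queryComputable_reweight {L : ℕ} (hL : 0 < L) (k s : ℕ) (st : (V → ℕ) × Finset V)
    (ω : WeightedDraws st.1 s) :
    QueryComputable (16 * L ^ 3 * s + Fintype.card V * 2) (reweight L k s st ω) := by
  have h1 := (queryComputable_auction ω.support hL k).mono
    (Nat.mul_le_mul_left _ ω.card_support_le)
  exact h1.bind fun R => (queryComputable_uncovered R.2.1 R.2.2).map fun U =>
    ((fun e => if e ∈ U then st.1 e + 1 else st.1 e,
      if st.2.card < R.1.card then R.1 else st.2) : (V → ℕ) × Finset V)

/-- Weak duality bounds the covered part of `J` by `|B₁| + |B₂|`, which exceeds `|I|` by at most `ε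
/ 4 * |J|`. -/
theorem le_card_inter_uncovered {M : Fin 2 → Matroid V} (hE : ∀ i, (M i).E = Set.univ) {k L : ℕ}
    (hrank : ∀ Z : Finset V, (M 0).Indep (Z : Set V) → Z.card ≤ k) (hk : 0 < k) {ε : ℝ}
    (hL : 0 < L) (hεL : 16 ≤ ε * L) {S I B₁ B₂ J : Finset V} (hJ : CommonIndep M J)
    (hkJ : k ≤ 2 * J.card) (h : auction (indepOracle M) S L k = (I, B₁, B₂))
    (hI : (I.card : ℝ) < (1 - ε) * J.card) :
    ε / 2 * J.card ≤ (J ∩ uncovered (indepOracle M) B₁ B₂).card := by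
  obtain ⟨-, hB₁, hB₂, -, -, hIk, -, hdual⟩ := auction_spec hE hrank hk hL S h
  have hcov : (J \ uncovered (indepOracle M) B₁ B₂).card ≤ B₁.card + B₂.card := by
    refine CommonIndep.card_le_of_subset_closure (M := M)
      (fun i => (hJ i).subset (by exact_mod_cast sdiff_subset)) fun e he => ?_
    have := (mem_sdiff.1 he).2
    rw [mem_uncovered_iff hE hB₁ hB₂] at this
    tauto
  have hsplit := card_sdiff_add_card_inter J (uncovered (indepOracle M) B₁ B₂)
  -- The error is `|I| + k ≤ 2 * k ≤ 4 * |J|`.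
  have hdual' : (L : ℝ) * (B₁.card + B₂.card) ≤ L * I.card + 4 * J.card := by
    have : L * (B₁.card + B₂.card) ≤ L * I.card + 4 * J.card := by omega
    exact_mod_cast this
  have hcov' : ((J \ uncovered (indepOracle M) B₁ B₂).card : ℝ) ≤ B₁.card + B₂.card := by
    exact_mod_cast hcov
  have hsplit' : ((J \ uncovered (indepOracle M) B₁ B₂).card : ℝ) +
      (J ∩ uncovered (indepOracle M) B₁ B₂).card = J.card := by exact_mod_cast hsplit
  have hL' : (0 : ℝ) < L := by exact_mod_cast hL
  have hJ0 : (0 : ℝ) ≤ J.card := Nat.cast_nonneg _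
  have h4 : (4 : ℝ) * J.card ≤ L * (ε / 4 * J.card) := by nlinarith
  have h5 : (B₁.card : ℝ) + B₂.card ≤ I.card + ε / 4 * J.card := by
    refine le_of_mul_le_mul_left ?_ hL'
    linarith
  have hε : 0 < ε := by
    by_contra hc
    nlinarith
  nlinarith

theorem sum_two_pow_reweight (cnt : V → ℕ) (U : Finset V) :
    ∑ e, 2 ^ (if e ∈ U then cnt e + 1 else cnt e) = ∑ e, 2 ^ cnt e + ∑ e ∈ U, 2 ^ cnt e := by
  rw [← sum_filter_add_sum_filter_not univ (· ∈ U), ← sum_filter_add_sum_filter_not univ (· ∈ U)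
    fun e => 2 ^ cnt e]
  have h1 : ∑ e ∈ univ.filter (· ∈ U), 2 ^ (if e ∈ U then cnt e + 1 else cnt e)
      = ∑ e ∈ univ.filter (· ∈ U), (2 ^ cnt e + 2 ^ cnt e) :=
    sum_congr rfl fun e he => by rw [if_pos (mem_filter.1 he).2]; ring
  have h2 : ∑ e ∈ univ.filter (· ∉ U), 2 ^ (if e ∈ U then cnt e + 1 else cnt e)
      = ∑ e ∈ univ.filter (· ∉ U), 2 ^ cnt e :=
    sum_congr rfl fun e he => by rw [if_neg (mem_filter.1 he).2]
  rw [h1, h2, sum_add_distrib, filter_univ_mem]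
  ring

omit [Fintype V] in
theorem sum_reweight (cnt : V → ℕ) (J U : Finset V) :
    ∑ e ∈ J, (if e ∈ U then cnt e + 1 else cnt e) = ∑ e ∈ J, cnt e + (J ∩ U).card := by
  have : ∀ e ∈ J, (if e ∈ U then cnt e + 1 else cnt e) = cnt e + if e ∈ U then 1 else 0 :=
    fun e _ => by split_ifs <;> rfl
  rw [sum_congr rfl this, sum_add_distrib, ← card_filter, filter_mem_eq_inter]

/-- The invariant after `i` rounds: the current set is good, or the total weight is small although
the elements of the optimal solution `J` have been left uncovered often. -/
def ReweightInvariant (M : Fin 2 → Matroid V) (J : Finset V) (ε : ℝ) (i : ℕ)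
    (st : (V → ℕ) × Finset V) : Prop :=
  CommonIndep M st.2 ∧ ((1 - ε) * J.card ≤ st.2.card ∨
    (((∑ e, 2 ^ st.1 e : ℕ) : ℝ) ≤ Fintype.card V * (1 + ε / 8) ^ i ∧
      i * (ε / 2 * J.card) ≤ (∑ e ∈ J, st.1 e : ℕ)))

/-- The certificate covers everything drawn, so the sample misses the uncovered set; outside the bad
draws that set must be light. -/
theorem ReweightInvariant.next {M : Fin 2 → Matroid V} (hE : ∀ i, (M i).E = Set.univ) {k L s : ℕ}
    (hrank : ∀ Z : Finset V, (M 0).Indep (Z : Set V) → Z.card ≤ k) (hk : 0 < k) {ε : ℝ}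
    (hε : 0 < ε) (hL : 0 < L) (hεL : 16 ≤ ε * L) {J : Finset V} (hJ : CommonIndep M J)
    (hkJ : k ≤ 2 * J.card) {i : ℕ} {st : (V → ℕ) × Finset V} (h : ReweightInvariant M J ε i st)
    {ω : WeightedDraws st.1 s}
    (hω : ω ∉ badDraws st.1 s k (ε / 8) (uncovered (indepOracle M))) :
    ReweightInvariant M J ε (i + 1) (reweight L k s st ω (indepOracle M)) := by
  obtain ⟨cnt, best⟩ := st
  obtain ⟨⟨I, B₁, B₂⟩, hR⟩ : ∃ R, auction (indepOracle M) ω.support L k = R := ⟨_, rfl⟩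
  obtain ⟨hI, hB₁, hB₂, hk₁, hk₂, -, hcov, -⟩ := auction_spec hE hrank hk hL _ hR
  set U := uncovered (indepOracle M) B₁ B₂ with hU
  have hnext : reweight L k s (cnt, best) ω (indepOracle M)
      = (fun e => if e ∈ U then cnt e + 1 else cnt e, if best.card < I.card then I else best) := by
    simp only [reweight, hR, hU]
  have hbest : best.card ≤ (if best.card < I.card then I else best).card ∧
      I.card ≤ (if best.card < I.card then I else best).card := by
    split_ifs <;> omega
  rw [hnext]
  refine ⟨?_, ?_⟩
  · change CommonIndep M (if best.card < I.card then I else best)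
    split_ifs
    · exact hI
    · exact h.1
  simp only
  by_cases hgood : (1 - ε) * J.card ≤ ((if best.card < I.card then I else best).card : ℝ)
  · exact Or.inl hgood
  right
  rw [not_le] at hgood
  have hIlt : (I.card : ℝ) < (1 - ε) * J.card :=
    (Nat.cast_le.2 hbest.2).trans_lt hgood
  have hbestlt : (best.card : ℝ) < (1 - ε) * J.card :=
    (Nat.cast_le.2 hbest.1).trans_lt hgood
  obtain ⟨hW, hC⟩ := h.2.resolve_left (not_le.2 hbestlt)
  simp only at hW hC
  have hlight : ((∑ e ∈ U, 2 ^ cnt e : ℕ) : ℝ) ≤ ε / 8 * (∑ e, 2 ^ cnt e : ℕ) := by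
    by_contra hc
    refine hω ⟨B₁, B₂, hk₁, hk₂, not_le.1 hc, fun j hj => ?_⟩
    rw [mem_uncovered_iff hE hB₁ hB₂] at hj
    rcases hcov (ω j).1 (mem_image_of_mem _ (mem_univ j)) with h1 | h1
    · exact hj.1 h1
    · exact hj.2 h1
  have hprog := le_card_inter_uncovered hE hrank hk hL hεL hJ hkJ hR hIlt
  rw [sum_two_pow_reweight, sum_reweight]
  constructor
  · rw [Nat.cast_add, pow_succ]
    have := mul_le_mul_of_nonneg_left hW (show (0 : ℝ) ≤ 1 + ε / 8 by positivity)
    linarith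
  · rw [Nat.cast_add, Nat.cast_add, Nat.cast_one]
    linarith

omit [DecidableEq V] in
-- Otherwise an average element of `J` has weight at least `2 ^ (ε * T / 2)`, which exceeds the
-- bound on the total weight.
theorem ReweightInvariant.good {M : Fin 2 → Matroid V} {J : Finset V} {ε : ℝ} {T : ℕ}
    {st : (V → ℕ) × Finset V} (h : ReweightInvariant M J ε T st) (hε : 0 < ε)
    (hn : 2 ≤ Fintype.card V) (hJ : J.Nonempty)
    (hT : 5 * Real.log (Fintype.card V) ≤ ε * T) :
    (1 - ε) * J.card ≤ st.2.card := by
  refine h.2.resolve_right ?_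
  rintro ⟨hW, hC⟩
  obtain ⟨e, he, hle⟩ : ∃ e ∈ J, T * (ε / 2) ≤ (st.1 e : ℝ) := by
    by_contra! hcon
    have h1 := sum_lt_sum_of_nonempty hJ hcon
    rw [sum_const, nsmul_eq_mul] at h1
    push_cast at hC
    linarith
  have hn' : (0 : ℝ) < Fintype.card V := by
    exact_mod_cast (by omega : 0 < Fintype.card V)
  have hpow : (2 : ℝ) ^ st.1 e ≤ Fintype.card V * (1 + ε / 8) ^ T := by
    refine le_trans ?_ hW
    exact_mod_cast single_le_sum (f := fun e => 2 ^ st.1 e) (fun _ _ => Nat.zero_le _) (mem_univ e)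
  have hlog := Real.log_le_log (by positivity) hpow
  rw [Real.log_mul hn'.ne' (by positivity), Real.log_pow, Real.log_pow] at hlog
  have h2 : Real.log (1 + ε / 8) ≤ ε / 8 := by
    have := Real.log_le_sub_one_of_pos (show (0 : ℝ) < 1 + ε / 8 by positivity)
    linarith
  have h3 := mul_le_mul_of_nonneg_left h2 (Nat.cast_nonneg (α := ℝ) T)
  have h4 := Real.log_two_gt_d9
  have h5 : 0 < Real.log (Fintype.card V) := Real.log_pos (by exact_mod_cast hn)
  -- Since `0.69 / 2 - 1 / 8 > 1 / 5`, the constant 5 in `hT` suffices.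
  have h6 : (T * (ε / 2)) * 0.69 ≤ st.1 e * Real.log 2 :=
    mul_le_mul hle (by linarith) (by norm_num) (Nat.cast_nonneg _)
  nlinarith

/-- Sampling rounds solve matroid intersection for matroids of bounded rank. -/
theorem exists_queryAlg_of_rank_le (hn : 2 ≤ Fintype.card V) {k L s T : ℕ} {ε δ : ℝ} (hε : 0 < ε)
    (hδ : 0 ≤ δ) (hL : 0 < L) (hεL : 16 ≤ ε * L)
    (hT : 5 * Real.log (Fintype.card V) ≤ ε * T)
    (hs : ((Fintype.card V + 1 : ℕ) : ℝ) ^ (2 * k) * Real.exp (-(ε / 8 * s)) ≤ δ)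
    (tr : (Fin 2 → Finset V → Bool) → Fin 2 → Finset V → Bool)
    (htr : ∀ i S, QueryComputable 1 fun O => tr O i S) :
    ∃ A : QueryAlg V, ∀ O : Fin 2 → Finset V → Bool,
      (∀ p ∈ (A.run O).support, p.2 ≤ T * (16 * L ^ 3 * s + Fintype.card V * 2)) ∧
      ∀ M : Fin 2 → Matroid V, (∀ i, (M i).E = Set.univ) →
        (∀ Z : Finset V, (M 0).Indep (Z : Set V) → Z.card ≤ k) → tr O = indepOracle M →
        ∀ J, CommonIndep M J → 0 < k → k ≤ 2 * J.card →
        (A.run O).toOuterMeasure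
          {p | p.1 ∈ {S | CommonIndep M S ∧ (1 - ε) * (J.card : ℝ) ≤ S.card}}ᶜ
          ≤ T * ENNReal.ofReal δ := by
  have : Nonempty V := Fintype.card_pos_iff.1 (by omega)
  have hne : ∀ st : (V → ℕ) × Finset V, Nonempty (WeightedDraws st.1 s) := fun st =>
    ⟨fun _ => ⟨Classical.arbitrary V, ⟨0, by positivity⟩⟩⟩
  obtain ⟨A, hA⟩ := exists_queryAlg_rounds (V := V) (σ := (V → ℕ) × Finset V)
    (fun st => WeightedDraws st.1 s) (fun st ω O => reweight L k s st ω (tr O))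
    (fun st ω => (queryComputable_reweight hL k s st ω).comp tr htr) Prod.snd T (fun _ => 0, ∅)
  refine ⟨A, fun O => ⟨(hA O).1, fun M hE hrank hO J hJ hk hkJ => ?_⟩⟩
  -- `j` counts the rounds still to come and `i` those already made.
  refine (hA O).2 _ _ (fun j st => ∃ i, i + j = T ∧ ReweightInvariant M J ε i st) ?_ ?_ ?_
  · rintro j st ⟨i, hij, hinv⟩
    have hsub : {ω : WeightedDraws st.1 s |
        ¬ ∃ i, i + j = T ∧ ReweightInvariant M J ε i (reweight L k s st ω (tr O))}
        ⊆ badDraws st.1 s k (ε / 8) (uncovered (indepOracle M)) := by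
      intro ω hω
      by_contra hc
      refine hω ⟨i + 1, by omega, ?_⟩
      rw [hO]
      exact hinv.next hE hrank hk hε hL hεL hJ hkJ hc
    have hcard : ((Nat.card {ω : WeightedDraws st.1 s //
        ¬ ∃ i, i + j = T ∧ ReweightInvariant M J ε i (reweight L k s st ω (tr O))} : ℕ) : ℝ)
        ≤ δ * Fintype.card (WeightedDraws st.1 s) := by
      refine le_trans ?_ ((ncard_badDraws_le st.1 s k (ε / 8) (uncovered (indepOracle M))
        ).trans (mul_le_mul_of_nonneg_right hs (Nat.cast_nonneg _)))
      exact_mod_cast Set.ncard_le_ncard hsub (Set.toFinite _)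
    have h1 := ENNReal.ofReal_le_ofReal hcard
    rwa [ENNReal.ofReal_mul hδ, ENNReal.ofReal_natCast, ENNReal.ofReal_natCast] at h1
  · rintro st ⟨i, hi, hinv⟩
    obtain rfl : i = T := by omega
    refine ⟨hinv.1, hinv.good hε hn ?_ hT⟩
    rw [← card_pos]
    omega
  · exact ⟨0, by omega, fun i => by simp, Or.inr (by simp)⟩

end Rounds

/-! ### Rank reduction by a greedy 2-approximation. -/

section Truncation

variable {V : Type u}

/-- Oracles for the given matroids with the first one truncated to rank `k`. -/
def capOracle (k : ℕ) (O : Fin 2 → Finset V → Bool) (i : Fin 2) (S : Finset V) : Bool :=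
  O i S && (decide (S.card ≤ k) || decide (i = 1))

theorem queryComputable_capOracle (k : ℕ) (i : Fin 2) (S : Finset V) :
    QueryComputable 1 fun O => capOracle k O i S :=
  (QueryComputable.ask i S).map fun b => b && (decide (S.card ≤ k) || decide (i = 1))

theorem capOracle_indepOracle [DecidableEq V] (k : ℕ) (M : Fin 2 → Matroid V) :
    capOracle k (indepOracle M) = indepOracle ![(M 0).truncateTo k, M 1] := by
  funext i S
  rw [Bool.eq_iff_iff, indepOracle_iff]
  fin_cases i
  · simp [capOracle, indepOracle_iff, Matroid.truncateTo_indep_iff]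
  · simp [capOracle, indepOracle_iff]

variable [Fintype V] [DecidableEq V]

/-- A common independent set that is maximal under inclusion. -/
noncomputable def greedyCommon (O : Fin 2 → Finset V → Bool) : Finset V :=
  greedy (fun S => O 0 S && O 1 S) (univ : Finset V).toList ∅

theorem queryComputable_greedyCommon :
    QueryComputable (Fintype.card V * 2) fun O => greedyCommon (V := V) O :=
  (QueryComputable.greedy (q := 2) (fun Y => (QueryComputable.ask 0 Y).bind fun a =>
    (QueryComputable.ask 1 Y).map fun b => a && b) _ _).mono (by simp)

theorem commonIndep_greedyCommon (M : Fin 2 → Matroid V) :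
    CommonIndep M (greedyCommon (indepOracle M)) := by
  have : (fun S => indepOracle M 0 S && indepOracle M 1 S) (greedyCommon (indepOracle M)) = true :=
    ind_greedy (ind := fun S => indepOracle M 0 S && indepOracle M 1 S) (by simp [indepOracle_iff])
  simp only [Bool.and_eq_true, indepOracle_iff] at this
  intro i
  fin_cases i
  · exact this.1
  · exact this.2

/-- By maximality the greedy set spans every element in one of the two matroids, so taken twice it
is a dual cover. -/
theorem CommonIndep.card_le_two_mul_greedyCommon {M : Fin 2 → Matroid V}
    (hE : ∀ i, (M i).E = Set.univ) {J : Finset V} (hJ : CommonIndep M J) :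
    J.card ≤ 2 * (greedyCommon (indepOracle M)).card := by
  rw [two_mul]
  refine hJ.card_le_of_subset_closure fun e _ => ?_
  have hI := commonIndep_greedyCommon M
  by_cases he : e ∈ greedyCommon (indepOracle M)
  · exact Or.inl ((M 0).subset_closure _ (by simp [hE]) (mem_coe.2 he))
  have h1 := not_ind_insert_greedy (ind := fun S => indepOracle M 0 S && indepOracle M 1 S)
    (fun A B hAB hB => by
      simp only [Bool.and_eq_true] at hB ⊢
      exact ⟨indepOracle_mono _ _ hAB hB.1, indepOracle_mono _ _ hAB hB.2⟩)
    (mem_toList.2 (mem_univ e)) he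
  simp only [Bool.and_eq_true, indepOracle_iff, coe_insert] at h1
  by_cases h2 : (M 0).Indep (insert e (greedyCommon (indepOracle M) : Set V))
  · exact Or.inr ((hI 1).mem_closure_of_not_indep_insert (hE 1) fun h3 => h1 ⟨h2, h3⟩)
  · exact Or.inl ((hI 0).mem_closure_of_not_indep_insert (hE 0) h2)

end Truncation

/-! ### Numerical estimates for the parameters. -/

section Parameters

theorem half_le_log {n : ℕ} (hn : 2 ≤ n) : 1 / 2 ≤ Real.log n := by
  have := Real.log_two_gt_d9
  have := Real.log_le_log (by norm_num) (show (2 : ℝ) ≤ n by exact_mod_cast hn)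
  linarith

/-- The failure probability of a single round. -/
theorem failure_probability_le {n c k s : ℕ} (hn : 2 ≤ n) {ε : ℝ}
    (hs : (4 * k + c + 6 : ℕ) * Real.log n ≤ ε / 8 * s) :
    ((n + 1 : ℕ) : ℝ) ^ (2 * k) * Real.exp (-(ε / 8 * s)) ≤ 1 / (n : ℝ) ^ (c + 6) := by
  have hn0 : (0 : ℝ) < n := by exact_mod_cast (by omega : 0 < n)
  -- `n + 1 ≤ n ^ 2` for `n ≥ 2`.
  have h1 : ((n + 1 : ℕ) : ℝ) ^ (2 * k) ≤ (n : ℝ) ^ (4 * k) := by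
    have : (n + 1) ^ (2 * k) ≤ n ^ (4 * k) := by
      rw [show 4 * k = 2 * (2 * k) by ring, pow_mul n]
      exact Nat.pow_le_pow_left (by nlinarith) _
    exact_mod_cast this
  have h2 : Real.exp (-(ε / 8 * s)) ≤ ((n : ℝ) ^ (4 * k + c + 6))⁻¹ := by
    rw [← Real.exp_log (pow_pos hn0 (4 * k + c + 6)), ← Real.exp_neg, Real.log_pow]
    exact Real.exp_le_exp.2 (neg_le_neg hs)
  refine (mul_le_mul h1 h2 (Real.exp_nonneg _) (by positivity)).trans (le_of_eq ?_)
  rw [show 4 * k + c + 6 = 4 * k + (c + 6) by ring, pow_add]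
  field_simp

/-- The lower bound on `ε` makes `T` at most `14 * n ^ 2 ≤ n ^ 6`, which explains the extra 6 in the
exponent. -/
theorem rounds_mul_failure_le {n c T : ℕ} (hn : 2 ≤ n) {ε : ℝ} (hε : 1 / (2 * n) ≤ ε)
    (hT : (T : ℝ) ≤ 7 * Real.log n / ε) :
    (T : ℝ) * (1 / (n : ℝ) ^ (c + 6)) ≤ 1 / (n : ℝ) ^ c := by
  have hn2 : (2 : ℝ) ≤ n := by exact_mod_cast hn
  have hn0 : (0 : ℝ) < n := by linarith
  have hε0 : 0 < ε := lt_of_lt_of_le (by positivity) hε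
  have h1 : (T : ℝ) ≤ 14 * n ^ 2 := by
    refine hT.trans ?_
    rw [div_le_iff₀ hε0]
    have h2 : Real.log n ≤ n := Real.log_le_self hn0.le
    have h3 : (7 : ℝ) * n ≤ 14 * n ^ 2 * ε := by
      rw [div_le_iff₀ (by positivity)] at hε
      nlinarith
    linarith
  have h2 : (14 : ℝ) * n ^ 2 ≤ n ^ 6 := by
    have : (2 : ℝ) ^ 4 ≤ n ^ 4 := pow_le_pow_left₀ (by norm_num) hn2 4
    nlinarith [sq_nonneg (n : ℝ)]
  rw [pow_add, mul_one_div, div_le_div_iff₀ (by positivity) (by positivity), one_mul, mul_comm]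
  exact mul_le_mul_of_nonneg_left (h1.trans h2) (by positivity)

/-- The total number of queries. -/
theorem query_count_le {n c k r L s T : ℕ} (hn : 2 ≤ n) {ε : ℝ} (hε : 0 < ε) (hε1 : ε < 1)
    (hr : 1 ≤ r) (hk : k ≤ 2 * r) (hL : (L : ℝ) ≤ 17 / ε) (hT : (T : ℝ) ≤ 7 * Real.log n / ε)
    (hs : (s : ℝ) ≤ 8 * (4 * k + c + 7) * Real.log n / ε) :
    ((n * 2 + T * (16 * L ^ 3 * s + n * 2) : ℕ) : ℝ)
      ≤ 9000000 * (c + 15) * (n * Real.log n / ε + r * Real.log n ^ 3 / ε ^ 5) := by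
  have hl := half_le_log hn
  set l := Real.log n
  have hl0 : 0 < l := by linarith
  have hr1 : (1 : ℝ) ≤ r := by exact_mod_cast hr
  have hc0 : (0 : ℝ) ≤ c := Nat.cast_nonneg c
  have hs' : (s : ℝ) ≤ 8 * (c + 15) * r * l / ε := by
    refine hs.trans ?_
    have hk' : (k : ℝ) ≤ 2 * r := by exact_mod_cast hk
    have : 8 * (4 * k + c + 7 : ℝ) ≤ 8 * (c + 15) * r := by nlinarith
    gcongr
  have h1 : (n : ℝ) * 2 ≤ 4 * (n * l / ε) := by
    rw [mul_div_assoc']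
    rw [le_div_iff₀ hε]
    nlinarith [Nat.cast_nonneg (α := ℝ) n, mul_nonneg (Nat.cast_nonneg (α := ℝ) n) hl0.le]
  have h2 : (T : ℝ) * (n * 2) ≤ 14 * (n * l / ε) := by
    refine (mul_le_mul_of_nonneg_right hT (by positivity)).trans (le_of_eq ?_)
    ring
  have h3 : (T : ℝ) * (16 * L ^ 3 * s) ≤ 4402048 * (c + 15) * (r * l ^ 2 / ε ^ 5) := by
    calc (T : ℝ) * (16 * L ^ 3 * s)
        ≤ (7 * l / ε) * (16 * (17 / ε) ^ 3 * (8 * (c + 15) * r * l / ε)) := by gcongr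
      _ = _ := by
        field_simp
        ring
  -- The count needs only two logarithms; the third is added using `1 ≤ 2 * l`.
  have h4 : (r : ℝ) * l ^ 2 / ε ^ 5 ≤ 2 * (r * l ^ 3 / ε ^ 5) := by
    rw [mul_div_assoc']
    refine div_le_div_of_nonneg_right ?_ (by positivity)
    nlinarith [mul_nonneg (Nat.cast_nonneg (α := ℝ) r) (sq_nonneg l)]
  have h5 : 0 ≤ (n : ℝ) * l / ε := by positivity
  have h6 : 0 ≤ (r : ℝ) * l ^ 3 / ε ^ 5 := by positivity
  have h7 : 4402048 * ((c : ℝ) + 15) * (r * l ^ 2 / ε ^ 5)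
      ≤ 4402048 * (c + 15) * (2 * (r * l ^ 3 / ε ^ 5)) :=
    mul_le_mul_of_nonneg_left h4 (by positivity)
  push_cast
  nlinarith [mul_nonneg hc0 h5, mul_nonneg hc0 h6]

theorem natCeil_le_of_one_le {x y : ℝ} (hx : 0 ≤ x) (h : x + 1 ≤ y) : (⌈x⌉₊ : ℝ) ≤ y :=
  (Nat.ceil_lt_add_one hx).le.trans h

end Parameters

/-! ### Assembly of the algorithm. -/

/-- Randomized approximate matroid intersection when `ε` is not too small. -/
theorem exists_queryAlg_matroid_intersection (c : ℕ) {V : Type u} [Fintype V] {n : ℕ}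
    (hcard : Fintype.card V = n) (hn : 2 ≤ n) {ε : ℝ} (hε : 1 / (2 * n) ≤ ε) (hε1 : ε < 1) :
    ∃ A : QueryAlg V, ∀ M : Fin 2 → Matroid V, (∀ i, (M i).E = Set.univ) →
      (∀ p ∈ (A.run (indepOracle M)).support, (p.2 : ℝ) ≤ 9000000 * (c + 15) *
        (n * Real.log n / ε + maxCommonIndep M * Real.log n ^ 3 / ε ^ 5)) ∧
      1 - 1 / (n : ℝ) ^ c ≤ ((A.run (indepOracle M)).toOuterMeasure
        {p | CommonIndep M p.1 ∧ (1 - ε) * (maxCommonIndep M : ℝ) ≤ (p.1.card : ℝ)}).toReal := by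
  classical
  subst hcard
  set n := Fintype.card V
  have hn0 : (0 : ℝ) < n := by exact_mod_cast (by omega : 0 < n)
  have hε0 : 0 < ε := lt_of_lt_of_le (by positivity) hε
  have hl := half_le_log hn
  have hlε : 1 / 2 ≤ Real.log n / ε := hl.trans (le_div_self (by linarith) hε0 hε1.le)
  set L := ⌈16 / ε⌉₊ with hLdef
  set T := ⌈5 * Real.log n / ε⌉₊ with hTdef
  have hL : 0 < L := Nat.ceil_pos.2 (by positivity)
  have hεL : 16 ≤ ε * L := by
    rw [mul_comm]
    exact (div_le_iff₀ hε0).1 (Nat.le_ceil _)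
  have hLle : (L : ℝ) ≤ 17 / ε := by
    refine natCeil_le_of_one_le (by positivity) ?_
    rw [show (17 : ℝ) = 16 + 1 by norm_num, add_div]
    have := one_le_one_div hε0 hε1.le
    linarith
  have hT : 5 * Real.log n ≤ ε * T := by
    rw [mul_comm ε]
    exact (div_le_iff₀ hε0).1 (Nat.le_ceil _)
  have hTle : (T : ℝ) ≤ 7 * Real.log n / ε := by
    refine natCeil_le_of_one_le (div_nonneg (by linarith) hε0.le) ?_
    rw [mul_div_assoc, mul_div_assoc]
    linarith
  let s : ℕ → ℕ := fun k => ⌈(4 * k + c + 6 : ℕ) * Real.log n * 8 / ε⌉₊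
  have hs : ∀ k, (4 * k + c + 6 : ℕ) * Real.log n ≤ ε / 8 * s k := fun k => by
    have := (div_le_iff₀ hε0).1 (Nat.le_ceil ((4 * k + c + 6 : ℕ) * Real.log n * 8 / ε))
    linarith
  have hsle : ∀ k : ℕ, (s k : ℝ) ≤ 8 * (4 * k + c + 7) * Real.log n / ε := fun k => by
    refine natCeil_le_of_one_le (div_nonneg (by positivity) hε0.le) ?_
    push_cast
    have : 8 * (4 * k + c + 7) * Real.log n / ε
        = (4 * k + c + 6) * Real.log n * 8 / ε + 8 * (Real.log n / ε) := by ring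
    rw [this]
    linarith
  have hδ : (0 : ℝ) ≤ 1 / (n : ℝ) ^ (c + 6) := by positivity
  choose A hA using fun k => exists_queryAlg_of_rank_le (V := V) hn (k := k) (s := s k) hε0 hδ
    hL hεL hT (failure_probability_le hn (hs k)) (capOracle k) (queryComputable_capOracle k)
  -- As `r` is unknown, the greedy set selects the rank bound at run time. If it is empty then `r =
  -- 0`.
  obtain ⟨A', hA'⟩ := (queryComputable_greedyCommon (V := V)).exists_queryAlg fun I =>
    if I = ∅ then .output ∅ else A (2 * I.card)
  refine ⟨A', fun M hE => ?_⟩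
  obtain ⟨d, hd, hrun⟩ := hA' (indepOracle M)
  obtain ⟨⟨J, hJ, hJr⟩, -⟩ := isGreatest_maxCommonIndep M
  have hJle := hJ.card_le_two_mul_greedyCommon hE
  have hge : (greedyCommon (indepOracle M)).card ≤ maxCommonIndep M :=
    (isGreatest_maxCommonIndep M).2 ⟨_, commonIndep_greedyCommon M, rfl⟩
  set I := greedyCommon (indepOracle M)
  by_cases hI : I = ∅
  · rw [if_pos hI] at hrun
    have hr0 : maxCommonIndep M = 0 := by simpa [← hJr, hI] using hJle
    rw [hrun, hr0]
    constructor
    · intro p hp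
      simp only [QueryAlg.run, PMF.mem_support_map_iff, PMF.mem_support_pure_iff] at hp
      obtain ⟨_, rfl, rfl⟩ := hp
      have hd' : ((0 + d : ℕ) : ℝ) ≤ 4 * n * (Real.log n / ε) := by
        have : ((0 + d : ℕ) : ℝ) ≤ n * 2 := by exact_mod_cast (by omega : 0 + d ≤ n * 2)
        nlinarith
      refine hd'.trans ?_
      have h1 : 0 ≤ n * (Real.log n / ε) := by positivity
      have h2 : 0 ≤ (c : ℝ) * (n * (Real.log n / ε)) := by positivity
      simp only [Nat.cast_zero, zero_mul, zero_div, add_zero, mul_div_assoc]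
      linarith
    · refine PMF.one_sub_le_toReal_toOuterMeasure _ _ (by positivity) ?_
      rw [PMF.toOuterMeasure_map_apply, QueryAlg.run, PMF.toOuterMeasure_pure_apply, if_neg]
      · exact zero_le
      · simp [CommonIndep]
  · rw [if_neg hI] at hrun
    have hIpos : 0 < I.card := card_pos.2 (nonempty_iff_ne_empty.2 hI)
    obtain ⟨hcost, hprob⟩ := hA (2 * I.card) (indepOracle M)
    rw [hrun]
    constructor
    · intro p hp
      rw [PMF.mem_support_map_iff] at hp
      obtain ⟨p', hp', rfl⟩ := hp
      refine le_trans ?_ (query_count_le hn hε0 hε1 (by omega) (Nat.mul_le_mul_left 2 hge) hLle hTle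
        (hsle (2 * I.card)))
      have : p'.2 ≤ T * (16 * L ^ 3 * s (2 * I.card) + n * 2) := hcost p' hp'
      exact_mod_cast (by omega : p'.2 + d ≤ n * 2 + T * (16 * L ^ 3 * s (2 * I.card) + n * 2))
    · refine PMF.one_sub_le_toReal_toOuterMeasure _ _ (by positivity) ?_
      rw [PMF.toOuterMeasure_map_apply]
      have hle := hprob ![(M 0).truncateTo (2 * I.card), M 1]
        (fun i => by fin_cases i <;> simp [hE])
        (fun Z hZ => ((M 0).truncateTo_indep_iff _ Z).1 hZ |>.2)
        (capOracle_indepOracle _ M) J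
        (fun i => by
          fin_cases i
          · exact ((M 0).truncateTo_indep_iff _ J).2 ⟨hJ 0, hJle⟩
          · exact hJ 1) (by omega) (by omega)
      refine (MeasureTheory.measure_mono ?_).trans (hle.trans ?_)
      · intro p hp hcon
        refine hp ⟨fun i => ?_, ?_⟩
        · fin_cases i
          · exact (((M 0).truncateTo_indep_iff _ p.1).1 (hcon.1 0)).1
          · exact hcon.1 1
        · rw [← hJr]
          exact hcon.2
      · rw [← ENNReal.ofReal_natCast, ← ENNReal.ofReal_mul (Nat.cast_nonneg _)]
        exact ENNReal.ofReal_le_ofReal (rounds_mul_failure_le hn hε hTle)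

theorem theorem1p2 (c : ℕ) :
    ∃ C : ℝ, 0 < C ∧
      ∀ (V : Type u) [Fintype V] (n : ℕ), Fintype.card V = n → 2 ≤ n →
      ∀ ε : ℝ, 0 < ε → ε < 1 →
      ∃ A : QueryAlg V,
        ∀ M : Fin 2 → Matroid V, (∀ i, (M i).E = Set.univ) →
          (∀ p ∈ (A.run (indepOracle M)).support,
            (p.2 : ℝ) ≤ C * (n * Real.log n / ε
              + maxCommonIndep M * Real.log n ^ 3 / ε ^ 5)) ∧
          1 - 1 / (n : ℝ) ^ c ≤
            ((A.run (indepOracle M)).toOuterMeasure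
              {p | CommonIndep M p.1 ∧
                (1 - ε) * (maxCommonIndep M : ℝ) ≤ (p.1.card : ℝ)}).toReal := by
  refine ⟨9000000 * (c + 15), by positivity, fun V _ n hcard hn ε hε hε1 => ?_⟩
  have hn2 : (2 : ℝ) ≤ n := by exact_mod_cast hn
  have hsmall : 1 / (2 * (n : ℝ)) < 1 := by
    rw [div_lt_one (by positivity)]
    linarith
  -- Raising `ε` to at least `1 / (2 * n)` only lowers the query bound.
  obtain ⟨A, hA⟩ := exists_queryAlg_matroid_intersection c hcard hn
    (le_max_right ε (1 / (2 * (n : ℝ)))) (max_lt hε1 hsmall)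
  refine ⟨A, fun M hE => ⟨fun p hp => ((hA M hE).1 p hp).trans ?_, (hA M hE).2.trans ?_⟩⟩
  · have := half_le_log hn
    gcongr <;> exact le_max_left _ _
  · refine ENNReal.toReal_mono ?_ (MeasureTheory.measure_mono fun p hp => ⟨hp.1, ?_⟩)
    · exact ((PMF.toOuterMeasure_le_one _ _).trans_lt ENNReal.one_lt_top).ne
    · have hr0 : (0 : ℝ) ≤ maxCommonIndep M := Nat.cast_nonneg _
      rcases le_total (1 / (2 * (n : ℝ))) ε with h | h
      · have hp2 := hp.2
        rwa [max_eq_left h] at hp2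
      · have hp2 := hp.2
        rw [max_eq_right h] at hp2
        have hrn : (maxCommonIndep M : ℝ) ≤ n := by
          obtain ⟨J, -, hJ⟩ := (isGreatest_maxCommonIndep M).1
          rw [← hJ, ← hcard]
          exact_mod_cast J.card_le_univ
        -- At `ε = 1 / (2 * n)` the loss is at most `1 / 2`, so integrality gives an exact optimum.
        have hlt : (maxCommonIndep M : ℝ) < p.1.card + 1 := by
          have h1 : 1 / (2 * (n : ℝ)) * maxCommonIndep M ≤ 1 / 2 := by
            rw [div_mul_eq_mul_div, one_mul, div_le_div_iff₀ (by positivity) (by norm_num)]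
            linarith
          linarith
        have hle : (maxCommonIndep M : ℝ) ≤ p.1.card := by
          exact_mod_cast Nat.lt_succ_iff.1 (by exact_mod_cast hlt)
        nlinarith
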